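/- For $m\ge 3$ let $C^m$ be the graph of vertices and edges of the $m$-dimensional cube: its vertices are the $m$-tuples over $\mathbb Z_2$, and two are joined if they differ in exactly one entry. For $i\neq j$ in $\{1,\dots,m\}$ and $a\in\mathbb Z_2^{m-2}$, the square $\{(i,j),a\}$ consists of the four $m$-tuples whose entries other than the $i$-th and the $j$-th are given by $a$; $(i,j)$ is an unordered pair. Consider tessellations of closed connected oriented surfaces by polygons with $m$ sides, four of which meet at every vertex (for $m\ge5$ the polygons can be taken to be regular right-angled hyperbolic $m$-gons). The dual graph has the polygons as vertices, two of them being joined if they share an edge. Let the family $\mathcal F_3$ consist of the decomposition of the sphere into eight right-angled triangles by the three coordinate planes. Given a tessellation in $\mathcal F_m$ whose dual graph is identified with $C^m$, suppose that for some pair of directions $i\ne j$ each of the $2^{m-2}$ squares $\{(i,j),a\}$ surrounds a vertex of the tessellation, at which its four polygons meet. Take two copies of the surface and cut off the corners of the polygons at all these vertices; this gives every polygon a new side and opens one hole for each of the squares. Glue every new side to the corresponding new side in the other copy (that is, in terms of the dual decomposition, join corresponding holes of the two copies by annuli made of four squares). The tessellations by $(m+1)$-gons obtained in this way form $\mathcal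 F_{m+1}$. Then for every $m\ge3$ the family $\mathcal F_m$ is non-empty, and for every tessellation in $\mathcal F_m$ there is an isomorphism of its dual graph with $C^m$ (that is, a choice of coordinates of the polygons) such that, for every square $\{(i,j),a\}$, the following are equivalent: (1) the square is a realised square, i.e. there is a vertex of the tessellation at which precisely the four polygons of the square come together; (2) $j\equiv i+1$ or $i\equiv j+1 \pmod m$. -/

import Mathlib

/-! ### Tessellated surfaces

A tessellation of a surface by polygons is recorded by the triangles of its barycentric subdivision
(a polygon with `m` sides is cut into `2 * m` triangles).  Every triangle has one corner at a vertex
of the tessellation, one at the midpoint of an edge and one at the centre of a polygon, and is glued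
along each of its three sides to one other triangle. -/

/-- Two elements are linked if one is reached from the other by applying `f` and `g`
(used with involutions). -/
def Linked {α : Type} (f g : α → α) : α → α → Prop :=
  Relation.EqvGen (fun x y => y = f x ∨ y = g x)

theorem Linked.setoid_equivalence {α : Type} (f g : α → α) : Equivalence (Linked f g) :=
  Relation.EqvGen.is_equivalence _

/-- A tessellation of a closed connected oriented surface by polygons with `m` sides, four of which
meet at every vertex (so that `m`-gons which are regular and right-angled may be used: for `m ≥ 5`
they are hyperbolic, made of `2 * m` triangles with angles `π / 2`, `π / m`, `π / 4`).

`Flag` is the set of triangles of the barycentric subdivision, and `r0`, `r1`, `r2` send a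
triangle to its neighbour across the side opposite to its corner at a vertex, at an edge midpoint,
at a polygon centre respectively.  So `r0 φ` and `φ` share the edge and the polygon, `r1 φ` and `φ`
share the vertex and the polygon, and `r2 φ` and `φ` share the vertex and the edge. -/
structure Tessellation (m : ℕ) where
  Flag : Type
  finite : Finite Flag
  nonempty : Nonempty Flag
  r0 : Flag → Flag
  r1 : Flag → Flag
  r2 : Flag → Flag
  r0_r0 : ∀ φ, r0 (r0 φ) = φ
  r1_r1 : ∀ φ, r1 (r1 φ) = φ
  r2_r2 : ∀ φ, r2 (r2 φ) = φ
  /-- Around the midpoint of every edge there are exactly four triangles. -/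
  r0_r2 : ∀ φ, r0 (r2 φ) = r2 (r0 φ)
  r0_r2_ne : ∀ φ, r0 (r2 φ) ≠ φ
  /-- The surface is connected. -/
  connected : ∀ φ ψ, Relation.EqvGen (fun x y => y = r0 x ∨ y = r1 x ∨ y = r2 x) φ ψ
  /-- The surface is orientable; in particular, no triangle is glued to itself. -/
  orientable : ∃ c : Flag → Bool,
    ∀ φ, c (r0 φ) = !(c φ) ∧ c (r1 φ) = !(c φ) ∧ c (r2 φ) = !(c φ)
  /-- Every polygon has `m` sides. -/
  polygon_ncard : ∀ φ, {ψ | Linked r0 r1 φ ψ}.ncard = 2 * m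
  /-- At every vertex four (corners of) polygons meet. -/
  vertex_ncard : ∀ φ, {ψ | Linked r1 r2 φ ψ}.ncard = 8

namespace Tessellation

variable {m : ℕ} (M : Tessellation m)

/-- The polygons of the tessellation. -/
def Polygon : Type := Quotient (Setoid.mk _ (Linked.setoid_equivalence M.r0 M.r1))

/-- The polygon of which a triangle is a part. -/
def polygonOf (φ : M.Flag) : M.Polygon :=
  Quotient.mk (Setoid.mk _ (Linked.setoid_equivalence M.r0 M.r1)) φ

/-- The dual graph: its vertices are the polygons, two of which are joined if they share an edge of
the tessellation. -/
def dualGraph : SimpleGraph M.Polygon where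
  Adj p q := p ≠ q ∧ ∃ φ, M.polygonOf φ = p ∧ M.polygonOf (M.r2 φ) = q
  symm := ⟨by
    rintro p q ⟨h, φ, hp, hq⟩
    exact ⟨h.symm, M.r2 φ, hq, by rw [M.r2_r2, hp]⟩⟩
  loopless := ⟨fun _ h => h.1 rfl⟩

/-- The gluing of the triangles along their sides; a triangle is parametrised by barycentric
coordinates, `0` belonging to the corner at a vertex of the tessellation, `1` to the corner at an
edge midpoint and `2` to the corner at a polygon centre. -/
def Glued (x y : (_ : M.Flag) × stdSimplex ℝ (Fin 3)) : Prop :=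
  x.2 = y.2 ∧
    ((x.2 0 = 0 ∧ y.1 = M.r0 x.1) ∨ (x.2 1 = 0 ∧ y.1 = M.r1 x.1) ∨ (x.2 2 = 0 ∧ y.1 = M.r2 x.1))

/-- The tessellated surface: the triangles glued along their sides, with the quotient topology. -/
def Surface : Type := Quot M.Glued

instance : TopologicalSpace M.Surface :=
  inferInstanceAs (TopologicalSpace (Quot M.Glued))

/-- The closed region of the surface covered by a polygon. -/
def region (p : M.Polygon) : Set M.Surface :=
  {z | ∃ φ x, M.polygonOf φ = p ∧ z = Quot.mk M.Glued ⟨φ, x⟩}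

/-- The point of the surface at the vertex of the tessellation which is a corner of a given
triangle. -/
def vertexPoint (φ : M.Flag) : M.Surface :=
  Quot.mk M.Glued ⟨φ, stdSimplex.vertex 0⟩

/-- The polygons that contain a given point of the surface. -/
def polygonsAt (z : M.Surface) : Set M.Polygon := {p | z ∈ M.region p}

end Tessellation

/-! ### Cubes -/

/-- The graph of vertices and edges of the `m`-dimensional cube. -/
def cubeGraph (m : ℕ) : SimpleGraph (Fin m → ZMod 2) where
  Adj x y := ∃! k, x k ≠ y k
  symm := ⟨fun x y h => by simpa only [ne_comm] using h⟩
  loopless := ⟨fun _ ⟨_, h, _⟩ => h rfl⟩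

/-- The four vertices of the square `{(i, j), a}` of the `m`-cube: the coordinates with numbers `i`
and `j` are free, the other `m - 2` coordinates are given by `a`. -/
def cubeSquare {m : ℕ} (i j : Fin m) (a : {k : Fin m // k ≠ i ∧ k ≠ j} → ZMod 2) :
    Set (Fin m → ZMod 2) :=
  {x | ∀ k, x k.1 = a k}

namespace Tessellation

/-- The square `{(i, j), a}` of the cube is realised on the tessellated surface, for a given choice
`χ` of coordinates of the polygons, if some vertex of the tessellation is a point at which the
four polygons of the square (and no others) come together. -/
def IsRealised {m : ℕ} (M : Tessellation m) (χ : M.dualGraph ≃g cubeGraph m) (i j : Fin m)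
    (a : {k : Fin m // k ≠ i ∧ k ≠ j} → ZMod 2) : Prop :=
  ∃ φ, χ '' M.polygonsAt (M.vertexPoint φ) = cubeSquare i j a

/-! ### Doubling -/

/-- A set of vertices of the tessellation, given by the triangles around them, such that
every polygon has exactly one corner at a vertex of the set. -/
structure HoleSet {m : ℕ} (M : Tessellation m) where
  carrier : Set M.Flag
  r1_mem : ∀ φ ∈ carrier, M.r1 φ ∈ carrier
  r2_mem : ∀ φ ∈ carrier, M.r2 φ ∈ carrier
  exists_corner : ∀ φ, ∃ η ∈ carrier, Linked M.r0 M.r1 φ η ∧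
    ∀ θ ∈ carrier, Linked M.r0 M.r1 φ θ → θ = η ∨ θ = M.r1 η

end Tessellation

theorem Linked.mem_iff {α : Type} {f g : α → α} (hf : ∀ x, f (f x) = x) (hg : ∀ x, g (g x) = x)
    {S : Set α} (hfS : ∀ x ∈ S, f x ∈ S) (hgS : ∀ x ∈ S, g x ∈ S) {x y : α} (h : Linked f g x y) :
    x ∈ S ↔ y ∈ S := by
  induction h with
  | rel x y h =>
    rcases h with rfl | rfl
    · exact ⟨hfS x, fun h => hf x ▸ hfS _ h⟩
    · exact ⟨hgS x, fun h => hg x ▸ hgS _ h⟩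
  | refl x => rfl
  | symm x y _ ih => exact ih.symm
  | trans x y z _ _ ih ih' => exact ih.trans ih'

theorem Linked.left {α : Type} (f g : α → α) (x : α) : Linked f g x (f x) :=
  Relation.EqvGen.rel _ _ (Or.inl rfl)

theorem Linked.right {α : Type} (f g : α → α) (x : α) : Linked f g x (g x) :=
  Relation.EqvGen.rel _ _ (Or.inr rfl)

/-- To link the images of linked elements it suffices to do so for single steps. -/
theorem Linked.lift {α β : Type} {f g : α → α} {f' g' : β → β} (u : α → β)
    (hf : ∀ x, Linked f' g' (u x) (u (f x))) (hg : ∀ x, Linked f' g' (u x) (u (g x))) {x y : α}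
    (h : Linked f g x y) : Linked f' g' (u x) (u y) := by
  induction h with
  | rel x y h =>
    rcases h with rfl | rfl
    · exact hf x
    · exact hg x
  | refl x => exact Relation.EqvGen.refl _
  | symm x y _ ih => exact Relation.EqvGen.symm _ _ ih
  | trans x y z _ _ ih ih' => exact Relation.EqvGen.trans _ _ _ ih ih'

namespace Tessellation.HoleSet

variable {m : ℕ} {M : Tessellation m} (H : M.HoleSet)

/-- The triangles of the doubled tessellation.  Take two copies (numbered by `Bool`) of the surface
and cut off, in both, the corners of the polygons at the vertices of `H`.  This opens a hole at each
of those vertices and gives every polygon a new side.  Each triangle `φ` at a vertex of `H` remains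
as the triangle `(inl φ, b)`, which now sits at one end of the new side, and is joined by the
triangle `(inr φ, b)`, which contains the half of the new side at that end. -/
abbrev DoubleFlag : Type := (M.Flag ⊕ {φ // φ ∈ H.carrier}) × Bool

def doubleR0 : H.DoubleFlag → H.DoubleFlag
  | (Sum.inl φ, b) => (Sum.inl (M.r0 φ), b)
  | (Sum.inr φ, b) => (Sum.inr ⟨M.r1 φ.1, H.r1_mem _ φ.2⟩, b)

open Classical in
noncomputable def doubleR1 : H.DoubleFlag → H.DoubleFlag
  | (Sum.inl φ, b) => if h : φ ∈ H.carrier then (Sum.inr ⟨φ, h⟩, b) else (Sum.inl (M.r1 φ), b)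
  | (Sum.inr φ, b) => (Sum.inl φ.1, b)

/-- The old sides are glued as before inside each copy; the new sides, which form the boundaries of
the holes, are glued to the corresponding new sides of the other copy.  In terms of the dual
squares, this joins corresponding holes of the two copies by an annulus made of four squares. -/
def doubleR2 : H.DoubleFlag → H.DoubleFlag
  | (Sum.inl φ, b) => (Sum.inl (M.r2 φ), b)
  | (Sum.inr φ, b) => (Sum.inr φ, !b)

theorem r1_mem_iff (φ : M.Flag) : M.r1 φ ∈ H.carrier ↔ φ ∈ H.carrier :=
  ⟨fun h => M.r1_r1 φ ▸ H.r1_mem _ h, H.r1_mem φ⟩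

theorem r2_mem_iff (φ : M.Flag) : M.r2 φ ∈ H.carrier ↔ φ ∈ H.carrier :=
  ⟨fun h => M.r2_r2 φ ▸ H.r2_mem _ h, H.r2_mem φ⟩

theorem doubleR1_of_mem {φ : M.Flag} (h : φ ∈ H.carrier) (b : Bool) :
    H.doubleR1 (Sum.inl φ, b) = (Sum.inr ⟨φ, h⟩, b) := by
  simp [doubleR1, h]

theorem doubleR1_of_notMem {φ : M.Flag} (h : φ ∉ H.carrier) (b : Bool) :
    H.doubleR1 (Sum.inl φ, b) = (Sum.inl (M.r1 φ), b) := by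
  simp [doubleR1, h]

theorem doubleR1_inr (φ : {φ // φ ∈ H.carrier}) (b : Bool) :
    H.doubleR1 (Sum.inr φ, b) = (Sum.inl φ.1, b) := rfl

theorem doubleR0_doubleR0 (x : H.DoubleFlag) : H.doubleR0 (H.doubleR0 x) = x := by
  rcases x with ⟨φ | ⟨φ, h⟩, b⟩ <;> simp [doubleR0, M.r0_r0, M.r1_r1]

theorem doubleR1_doubleR1 (x : H.DoubleFlag) : H.doubleR1 (H.doubleR1 x) = x := by
  rcases x with ⟨φ | ⟨φ, h⟩, b⟩
  · by_cases h : φ ∈ H.carrier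
    · rw [H.doubleR1_of_mem h, doubleR1_inr]
    · rw [H.doubleR1_of_notMem h, H.doubleR1_of_notMem (by rwa [r1_mem_iff]), M.r1_r1]
  · rw [doubleR1_inr, H.doubleR1_of_mem h]

theorem doubleR2_doubleR2 (x : H.DoubleFlag) : H.doubleR2 (H.doubleR2 x) = x := by
  rcases x with ⟨φ | ⟨φ, h⟩, b⟩ <;> simp [doubleR2, M.r2_r2]

theorem r2_ne (φ : M.Flag) : M.r2 φ ≠ φ := by
  obtain ⟨c, hc⟩ := M.orientable
  intro h
  have := (hc φ).2.2
  rw [h] at this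
  simp at this

theorem r1_ne (φ : M.Flag) : M.r1 φ ≠ φ := by
  obtain ⟨c, hc⟩ := M.orientable
  intro h
  have := (hc φ).2.1
  rw [h] at this
  simp at this

/-- Each step `r1` of the original tessellation can be made inside a polygon of the double. -/
theorem linked_r1 (φ : M.Flag) (b : Bool) :
    Linked H.doubleR0 H.doubleR1 (Sum.inl φ, b) (Sum.inl (M.r1 φ), b) := by
  by_cases h : φ ∈ H.carrier
  · have h1 := Linked.right H.doubleR0 H.doubleR1 (Sum.inl φ, b)
    rw [H.doubleR1_of_mem h] at h1
    have h2 := Linked.left H.doubleR0 H.doubleR1 (Sum.inr ⟨φ, h⟩, b)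
    have h3 := Linked.right H.doubleR0 H.doubleR1 (H.doubleR0 (Sum.inr ⟨φ, h⟩, b))
    exact Relation.EqvGen.trans _ _ _ (Relation.EqvGen.trans _ _ _ h1 h2) h3
  · have h1 := Linked.right H.doubleR0 H.doubleR1 (Sum.inl φ, b)
    rwa [H.doubleR1_of_notMem h] at h1

theorem linked_inl {φ ψ : M.Flag} (h : Linked M.r0 M.r1 φ ψ) (b : Bool) :
    Linked H.doubleR0 H.doubleR1 (Sum.inl φ, b) (Sum.inl ψ, b) :=
  Linked.lift (fun φ => ((Sum.inl φ, b) : H.DoubleFlag))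
    (fun φ => Linked.left H.doubleR0 H.doubleR1 (Sum.inl φ, b)) (fun φ => H.linked_r1 φ b) h

/-- The triangle of the original tessellation from which a triangle of the double comes. -/
def origin : H.DoubleFlag → M.Flag
  | (Sum.inl φ, _) => φ
  | (Sum.inr φ, _) => φ.1

theorem linked_origin (x : H.DoubleFlag) :
    Linked H.doubleR0 H.doubleR1 x (Sum.inl (H.origin x), x.2) := by
  rcases x with ⟨φ | φ, b⟩
  · exact Relation.EqvGen.refl _
  · exact Linked.right H.doubleR0 H.doubleR1 (Sum.inr φ, b)

theorem linked_iff (x y : H.DoubleFlag) :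
    Linked H.doubleR0 H.doubleR1 x y ↔ Linked M.r0 M.r1 (H.origin x) (H.origin y) ∧ x.2 = y.2 := by
  constructor
  · intro h
    have key : ∀ z : H.DoubleFlag, Linked M.r0 M.r1 (H.origin z) (H.origin (H.doubleR0 z)) ∧
        Linked M.r0 M.r1 (H.origin z) (H.origin (H.doubleR1 z)) ∧
        z.2 = (H.doubleR0 z).2 ∧ z.2 = (H.doubleR1 z).2 := by
      rintro ⟨φ | φ, b⟩
      · refine ⟨Linked.left M.r0 M.r1 φ, ?_, rfl, ?_⟩
        · by_cases h : φ ∈ H.carrier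
          · rw [H.doubleR1_of_mem h]
            exact Relation.EqvGen.refl _
          · rw [H.doubleR1_of_notMem h]
            exact Linked.right M.r0 M.r1 φ
        · by_cases h : φ ∈ H.carrier
          · rw [H.doubleR1_of_mem h]
          · rw [H.doubleR1_of_notMem h]
      · exact ⟨Linked.right M.r0 M.r1 φ.1, Relation.EqvGen.refl _, rfl, rfl⟩
    induction h with
    | rel x y h =>
      rcases h with rfl | rfl
      · exact ⟨(key x).1, (key x).2.2.1⟩
      · exact ⟨(key x).2.1, (key x).2.2.2⟩
    | refl x => exact ⟨Relation.EqvGen.refl _, rfl⟩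
    | symm x y _ ih => exact ⟨Relation.EqvGen.symm _ _ ih.1, ih.2.symm⟩
    | trans x y z _ _ ih ih' =>
      exact ⟨Relation.EqvGen.trans _ _ _ ih.1 ih'.1, ih.2.trans ih'.2⟩
  · rintro ⟨h, hb⟩
    have h1 := H.linked_origin x
    have h2 := H.linked_origin y
    have h3 := H.linked_inl h x.2
    rw [← hb] at h2
    exact Relation.EqvGen.trans _ _ _ (Relation.EqvGen.trans _ _ _ h1 h3)
      (Relation.EqvGen.symm _ _ h2)

theorem double_polygon_ncard (x : H.DoubleFlag) :
    {y | Linked H.doubleR0 H.doubleR1 x y}.ncard = 2 * (m + 1) := by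
  have := M.finite
  obtain ⟨η, hη, hl, hu⟩ := H.exists_corner (H.origin x)
  have hset : {y | Linked H.doubleR0 H.doubleR1 x y} =
      (fun ψ => ((Sum.inl ψ, x.2) : H.DoubleFlag)) '' {ψ | Linked M.r0 M.r1 (H.origin x) ψ} ∪
      (fun ψ => ((Sum.inr ψ, x.2) : H.DoubleFlag)) ''
        {⟨η, hη⟩, ⟨M.r1 η, H.r1_mem _ hη⟩} := by
    ext ⟨φ | ⟨φ, hφ⟩, b⟩
    · simp only [Set.mem_ofPred_eq, linked_iff, origin, Set.mem_union, Set.mem_image, Prod.mk.injEq,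
        Sum.inl.injEq, reduceCtorEq, false_and, and_false, exists_false, or_false]
      constructor
      · rintro ⟨h, hb⟩
        exact ⟨φ, h, rfl, hb⟩
      · rintro ⟨_, h, rfl, hb⟩
        exact ⟨h, hb⟩
    · simp only [Set.mem_ofPred_eq, linked_iff, origin, Set.mem_union, Set.mem_image, Prod.mk.injEq,
        Sum.inr.injEq, reduceCtorEq, false_and, and_false, exists_false, false_or]
      constructor
      · rintro ⟨h, hb⟩
        refine ⟨⟨φ, hφ⟩, ?_, rfl, hb⟩
        rcases hu φ hφ h with rfl | rfl <;> simp
      · rintro ⟨ψ, h, hψ, hb⟩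
        refine ⟨?_, hb⟩
        subst hψ
        simp only [Set.mem_insert_iff, Set.mem_singleton_iff, Subtype.mk.injEq] at h
        rcases h with rfl | rfl
        · exact hl
        · exact Relation.EqvGen.trans _ _ _ hl (Linked.right M.r0 M.r1 η)
  have : Finite H.DoubleFlag :=
    inferInstanceAs (Finite ((M.Flag ⊕ {φ // φ ∈ H.carrier}) × Bool))
  rw [hset, Set.ncard_union_eq, Set.ncard_image_of_injective, Set.ncard_image_of_injective,
    M.polygon_ncard, Set.ncard_pair]
  · ring
  · intro h
    exact r1_ne η (congrArg Subtype.val h).symm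
  · intro a b h
    simpa using h
  · intro a b h
    simpa using h
  · rw [Set.disjoint_left]
    rintro _ ⟨a, _, rfl⟩ ⟨b, _, h⟩
    simp at h

theorem double_vertex_ncard (x : H.DoubleFlag) :
    {y | Linked H.doubleR1 H.doubleR2 x y}.ncard = 8 := by
  have := M.finite
  have : Finite H.DoubleFlag :=
    inferInstanceAs (Finite ((M.Flag ⊕ {φ // φ ∈ H.carrier}) × Bool))
  by_cases hx : H.origin x ∈ H.carrier
  · set φ := H.origin x with hφ
    have hφ2 : M.r2 φ ∈ H.carrier := H.r2_mem _ hx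
    set T : Set (M.Flag ⊕ {φ // φ ∈ H.carrier}) :=
      {Sum.inl φ, Sum.inl (M.r2 φ), Sum.inr ⟨φ, hx⟩, Sum.inr ⟨M.r2 φ, hφ2⟩} with hT
    have hTcard : T.ncard = 4 := by
      have hne : φ ≠ M.r2 φ := (r2_ne φ).symm
      rw [hT, Set.ncard_insert_of_notMem, Set.ncard_insert_of_notMem, Set.ncard_pair]
      · simpa using hne
      · simp
      · simpa using hne
    have hset : {y | Linked H.doubleR1 H.doubleR2 x y} =
        (show Set H.DoubleFlag from T ×ˢ (Set.univ : Set Bool)) := by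
      have hxT : x ∈ (show Set H.DoubleFlag from T ×ˢ (Set.univ : Set Bool)) := by
        rcases x with ⟨ψ | ψ, b⟩ <;> refine ⟨?_, trivial⟩ <;> simp [hT, hφ, origin]
      have e1 : ∀ b, Linked H.doubleR1 H.doubleR2 (Sum.inl φ, b) (Sum.inr ⟨φ, hx⟩, b) := by
        intro b
        have := Linked.left H.doubleR1 H.doubleR2 (Sum.inl φ, b)
        rwa [H.doubleR1_of_mem hx] at this
      have e2 : ∀ b, Linked H.doubleR1 H.doubleR2 (Sum.inl φ, b) (Sum.inl (M.r2 φ), b) :=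
        fun b => Linked.right H.doubleR1 H.doubleR2 (Sum.inl φ, b)
      have e3 : ∀ b, Linked H.doubleR1 H.doubleR2 (Sum.inl (M.r2 φ), b)
          (Sum.inr ⟨M.r2 φ, hφ2⟩, b) := by
        intro b
        have := Linked.left H.doubleR1 H.doubleR2 (Sum.inl (M.r2 φ), b)
        rwa [H.doubleR1_of_mem hφ2] at this
      have e4 : ∀ b, Linked H.doubleR1 H.doubleR2 (Sum.inr ⟨φ, hx⟩, b) (Sum.inr ⟨φ, hx⟩, !b) :=
        fun b => Linked.right H.doubleR1 H.doubleR2 (Sum.inr ⟨φ, hx⟩, b)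
      have base : ∀ b, Linked H.doubleR1 H.doubleR2 (Sum.inl φ, false) (Sum.inl φ, b) := by
        intro b
        cases b
        · exact Relation.EqvGen.refl _
        · exact Relation.EqvGen.trans _ _ _ (Relation.EqvGen.trans _ _ _ (e1 false) (e4 false))
            (Relation.EqvGen.symm _ _ (e1 true))
      have all : ∀ y ∈ (show Set H.DoubleFlag from T ×ˢ (Set.univ : Set Bool)),
          Linked H.doubleR1 H.doubleR2 (Sum.inl φ, false) y := by
        rintro ⟨t, b⟩ ⟨ht, -⟩
        rcases ht with rfl | rfl | rfl | rfl
        · exact base b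
        · exact Relation.EqvGen.trans _ _ _ (base b) (e2 b)
        · exact Relation.EqvGen.trans _ _ _ (base b) (e1 b)
        · exact Relation.EqvGen.trans _ _ _ (base b)
            (Relation.EqvGen.trans _ _ _ (e2 b) (e3 b))
      ext y
      constructor
      · intro h
        refine (Linked.mem_iff H.doubleR1_doubleR1 H.doubleR2_doubleR2 ?_ ?_ h).1 hxT
        · rintro ⟨t, b⟩ ⟨ht, -⟩
          rcases ht with rfl | rfl | rfl | rfl
          · rw [H.doubleR1_of_mem hx]
            exact ⟨by simp [hT], trivial⟩
          · rw [H.doubleR1_of_mem hφ2]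
            exact ⟨by simp [hT], trivial⟩
          · exact ⟨by simp [hT, doubleR1], trivial⟩
          · exact ⟨by simp [hT, doubleR1], trivial⟩
        · rintro ⟨t, b⟩ ⟨ht, -⟩
          rcases ht with rfl | rfl | rfl | rfl
          · exact ⟨by simp [hT, doubleR2], trivial⟩
          · exact ⟨by simp [hT, doubleR2, M.r2_r2], trivial⟩
          · exact ⟨by simp [hT, doubleR2], trivial⟩
          · exact ⟨by simp [hT, doubleR2], trivial⟩
      · intro h
        exact Relation.EqvGen.trans _ _ _ (Relation.EqvGen.symm _ _ (all x hxT)) (all y h)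
    rw [hset]
    change (T ×ˢ (Set.univ : Set Bool)).ncard = 8
    rw [Set.ncard_prod, hTcard, Set.ncard_univ]
    simp
  · rcases x with ⟨φ | φ, b⟩
    · replace hx : φ ∉ H.carrier := hx
      have hmem : ∀ ψ, Linked M.r1 M.r2 φ ψ → ψ ∉ H.carrier := fun ψ h hψ =>
        hx ((Linked.mem_iff M.r1_r1 M.r2_r2 H.r1_mem H.r2_mem h).2 hψ)
      have hset : {y | Linked H.doubleR1 H.doubleR2 (Sum.inl φ, b) y} =
          (fun ψ => ((Sum.inl ψ, b) : H.DoubleFlag)) '' {ψ | Linked M.r1 M.r2 φ ψ} := by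
        ext y
        constructor
        · intro h
          refine (Linked.mem_iff H.doubleR1_doubleR1 H.doubleR2_doubleR2 ?_ ?_ h).1
            ⟨φ, Relation.EqvGen.refl _, rfl⟩
          · rintro _ ⟨ψ, hψ, rfl⟩
            exact ⟨M.r1 ψ, Relation.EqvGen.trans _ _ _ hψ (Linked.left M.r1 M.r2 ψ),
              (H.doubleR1_of_notMem (hmem ψ hψ) b).symm⟩
          · rintro _ ⟨ψ, hψ, rfl⟩
            exact ⟨M.r2 ψ, Relation.EqvGen.trans _ _ _ hψ (Linked.right M.r1 M.r2 ψ), rfl⟩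
        · rintro ⟨ψ, hψ, rfl⟩
          -- make the steps one by one, keeping away from the holes
          have key : ∀ ψ₁ ψ₂, Linked M.r1 M.r2 ψ₁ ψ₂ → ψ₁ ∉ H.carrier →
              Linked H.doubleR1 H.doubleR2 (Sum.inl ψ₁, b) (Sum.inl ψ₂, b) := by
            intro ψ₁ ψ₂ h
            induction h with
            | rel u v h =>
              intro hu
              rcases h with rfl | rfl
              · have := Linked.left H.doubleR1 H.doubleR2 (Sum.inl u, b)
                rwa [H.doubleR1_of_notMem hu] at this
              · exact Linked.right H.doubleR1 H.doubleR2 (Sum.inl u, b)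
            | refl u => exact fun _ => Relation.EqvGen.refl _
            | symm u v huv ih =>
              intro hv
              exact Relation.EqvGen.symm _ _ (ih fun hu =>
                hv ((Linked.mem_iff M.r1_r1 M.r2_r2 H.r1_mem H.r2_mem huv).1 hu))
            | trans u v w huv hvw ih ih' =>
              intro hu
              exact Relation.EqvGen.trans _ _ _ (ih hu) (ih' fun hv =>
                hu ((Linked.mem_iff M.r1_r1 M.r2_r2 H.r1_mem H.r2_mem huv).2 hv))
          exact key φ ψ hψ hx
      rw [hset, Set.ncard_image_of_injective, M.vertex_ncard]
      intro u v h
      simpa using h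
    · exact absurd φ.2 hx

theorem double_connected (x y : H.DoubleFlag) :
    Relation.EqvGen
      (fun x y => y = H.doubleR0 x ∨ y = H.doubleR1 x ∨ y = H.doubleR2 x) x y := by
  have hl : ∀ x y, Linked H.doubleR0 H.doubleR1 x y → Relation.EqvGen
      (fun x y => y = H.doubleR0 x ∨ y = H.doubleR1 x ∨ y = H.doubleR2 x) x y := by
    intro x y h
    refine Relation.EqvGen.mono ?_ _ _ h
    rintro u v (h | h)
    · exact Or.inl h
    · exact Or.inr (Or.inl h)
  have hstep : ∀ φ ψ b, Relation.EqvGen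
      (fun x y => y = H.doubleR0 x ∨ y = H.doubleR1 x ∨ y = H.doubleR2 x)
      (Sum.inl φ, b) (Sum.inl ψ, b) := by
    intro φ ψ b
    have h := M.connected φ ψ
    induction h with
    | rel u v h =>
      rcases h with rfl | rfl | rfl
      · exact Relation.EqvGen.rel _ _ (Or.inl rfl)
      · exact hl _ _ (H.linked_r1 u b)
      · exact Relation.EqvGen.rel _ _ (Or.inr (Or.inr rfl))
    | refl u => exact Relation.EqvGen.refl _
    | symm u v _ ih => exact Relation.EqvGen.symm _ _ ih
    | trans u v w _ _ ih ih' => exact Relation.EqvGen.trans _ _ _ ih ih'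
  obtain ⟨φ₀⟩ := M.nonempty
  obtain ⟨η, hη, -⟩ := H.exists_corner φ₀
  have hcross : ∀ b, Relation.EqvGen
      (fun x y => y = H.doubleR0 x ∨ y = H.doubleR1 x ∨ y = H.doubleR2 x)
      (Sum.inl η, false) (Sum.inl η, b) := by
    intro b
    cases b
    · exact Relation.EqvGen.refl _
    · have h1 := H.linked_origin (Sum.inr ⟨η, hη⟩, false)
      have h2 := H.linked_origin (Sum.inr ⟨η, hη⟩, true)
      exact Relation.EqvGen.trans _ _ _ (Relation.EqvGen.symm _ _ (hl _ _ h1))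
        (Relation.EqvGen.trans _ _ _
          (Relation.EqvGen.rel _ (Sum.inr ⟨η, hη⟩, true) (Or.inr (Or.inr rfl))) (hl _ _ h2))
  have hall : ∀ x, Relation.EqvGen
      (fun x y => y = H.doubleR0 x ∨ y = H.doubleR1 x ∨ y = H.doubleR2 x)
      (Sum.inl η, false) x := by
    intro x
    exact Relation.EqvGen.trans _ _ _ (Relation.EqvGen.trans _ _ _ (hcross x.2)
      (hstep η (H.origin x) x.2)) (Relation.EqvGen.symm _ _ (hl _ _ (H.linked_origin x)))
  exact Relation.EqvGen.trans _ _ _ (Relation.EqvGen.symm _ _ (hall x)) (hall y)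

theorem double_orientable : ∃ c : H.DoubleFlag → Bool, ∀ x,
    c (H.doubleR0 x) = !(c x) ∧ c (H.doubleR1 x) = !(c x) ∧ c (H.doubleR2 x) = !(c x) := by
  obtain ⟨c, hc⟩ := M.orientable
  refine ⟨fun x => match x with
    | (Sum.inl φ, b) => xor (c φ) b
    | (Sum.inr φ, b) => !(xor (c φ.1) b), ?_⟩
  rintro ⟨φ | φ, b⟩
  · refine ⟨?_, ?_, ?_⟩
    · simp [doubleR0, (hc φ).1]
    · by_cases h : φ ∈ H.carrier
      · rw [H.doubleR1_of_mem h]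
      · rw [H.doubleR1_of_notMem h]
        simp [(hc φ).2.1]
    · simp [doubleR2, (hc φ).2.2]
  · refine ⟨?_, ?_, ?_⟩
    · simp [doubleR0, (hc φ.1).2.1]
    · simp [doubleR1]
    · simp [doubleR2]

/-- The double of a tessellation by `m`-gons, a tessellation by `(m + 1)`-gons. -/
noncomputable def double : Tessellation (m + 1) where
  Flag := H.DoubleFlag
  finite := by
    have := M.finite
    exact inferInstanceAs (Finite ((M.Flag ⊕ {φ // φ ∈ H.carrier}) × Bool))
  nonempty := by
    obtain ⟨φ⟩ := M.nonempty
    exact ⟨(Sum.inl φ, false)⟩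
  r0 := H.doubleR0
  r1 := H.doubleR1
  r2 := H.doubleR2
  r0_r0 := H.doubleR0_doubleR0
  r1_r1 := H.doubleR1_doubleR1
  r2_r2 := H.doubleR2_doubleR2
  r0_r2 := by
    rintro ⟨φ | φ, b⟩ <;> simp [doubleR0, doubleR2, M.r0_r2]
  r0_r2_ne := by
    rintro ⟨φ | φ, b⟩
    · simpa [doubleR0, doubleR2] using M.r0_r2_ne φ
    · simp [doubleR0, doubleR2]
  connected := H.double_connected
  orientable := H.double_orientable
  polygon_ncard := H.double_polygon_ncard
  vertex_ncard := H.double_vertex_ncard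

end Tessellation.HoleSet

/-! ### The octahedral tessellation of the sphere -/

namespace Octahedron

/-- The sphere in `ℝ³` is cut by the three coordinate planes into eight right-angled triangles, one
for each choice `s` of signs of the coordinates.  The triangle `(s, (i, k))` of the barycentric
subdivision lies in the polygon with signs `s`, next to its side in the plane where the coordinate
`i` vanishes, and has a corner at the vertex of the polygon on the axis number `k`. -/
abbrev Flag : Type := (Fin 3 → Bool) × {e : Fin 3 × Fin 3 // e.1 ≠ e.2}

/-- The element of `Fin 3` different from two given ones is minus their sum. -/
def r0 (x : Flag) : Flag :=
  (x.1, ⟨(x.2.1.1, -(x.2.1.1 + x.2.1.2)), by revert x; decide⟩)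

def r1 (x : Flag) : Flag :=
  (x.1, ⟨(-(x.2.1.1 + x.2.1.2), x.2.1.2), by revert x; decide⟩)

def r2 (x : Flag) : Flag :=
  (Function.update x.1 x.2.1.1 (!(x.1 x.2.1.1)), x.2)

theorem r0_r0 : ∀ x, r0 (r0 x) = x := by decide

theorem r1_r1 : ∀ x, r1 (r1 x) = x := by decide

theorem r2_r2 (x : Flag) : r2 (r2 x) = x := by
  simp [r2]

theorem r0_r2 (x : Flag) : r0 (r2 x) = r2 (r0 x) := rfl

theorem r0_r2_ne (x : Flag) : r0 (r2 x) ≠ x := by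
  intro h
  have h1 := congrFun (congrArg Prod.fst h) x.2.1.1
  simp [r0, r2] at h1

theorem polygon_eq (x : Flag) : {y | Linked r0 r1 x y} = {y | y.1 = x.1} := by
  ext y
  constructor
  · intro h
    exact (Linked.mem_iff (S := {y | y.1 = x.1}) r0_r0 r1_r1 (fun _ h => h) (fun _ h => h) h).1 rfl
  · obtain ⟨s, e⟩ := x
    obtain ⟨t, e'⟩ := y
    intro h
    obtain rfl : t = s := h
    have key : ∀ e e' : {e : Fin 3 × Fin 3 // e.1 ≠ e.2},
        e' = e ∨ e'.1 = (e.1.1, -(e.1.1 + e.1.2)) ∨ e'.1 = (-(e.1.1 + e.1.2), e.1.2) ∨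
        e'.1 = (-(e.1.1 + e.1.2), e.1.1) ∨ e'.1 = (e.1.2, -(e.1.1 + e.1.2)) ∨
        e'.1 = (e.1.2, e.1.1) := by decide
    have l0 : ∀ z, Linked r0 r1 z (r0 z) := Linked.left r0 r1
    have l1 : ∀ z, Linked r0 r1 z (r1 z) := Linked.right r0 r1
    have tr : ∀ {u v w}, Linked r0 r1 u v → Linked r0 r1 v w → Linked r0 r1 u w :=
      fun h h' => Relation.EqvGen.trans _ _ _ h h'
    have hs : ∀ {a b : {e : Fin 3 × Fin 3 // e.1 ≠ e.2}}, a.1 = b.1 → ((t, a) : Flag) = (t, b) :=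
      fun h => by rw [Subtype.ext h]
    rcases key e e' with h | h | h | h | h | h
    · subst h
      exact Relation.EqvGen.refl _
    · have := l0 (t, e)
      rwa [show r0 (t, e) = (t, e') from hs h.symm] at this
    · have := l1 (t, e)
      rwa [show r1 (t, e) = (t, e') from hs h.symm] at this
    · have := tr (l1 (t, e)) (l0 _)
      rwa [show r0 (r1 (t, e)) = (t, e') from hs (by rw [h]; simp [r1])] at this
    · have := tr (l0 (t, e)) (l1 _)
      rwa [show r1 (r0 (t, e)) = (t, e') from hs (by rw [h]; simp [r0])] at this
    · have := tr (tr (l0 (t, e)) (l1 _)) (l0 _)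
      rwa [show r0 (r1 (r0 (t, e))) = (t, e') from hs (by rw [h]; simp [r0, r1])] at this

theorem polygon_ncard (x : Flag) : {y | Linked r0 r1 x y}.ncard = 2 * 3 := by
  have h : {y : Flag | y.1 = x.1} = ({x.1} : Set (Fin 3 → Bool)) ×ˢ Set.univ := by
    ext y
    simp
  have h6 : Fintype.card {e : Fin 3 × Fin 3 // e.1 ≠ e.2} = 6 := by decide
  rw [polygon_eq, h, Set.ncard_prod, Set.ncard_singleton, Set.ncard_univ, Nat.card_eq_fintype_card,
    h6]

theorem linked_r1_r2 (s : Fin 3 → Bool) (e : {e : Fin 3 × Fin 3 // e.1 ≠ e.2}) (j : Fin 3)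
    (hj : j ≠ e.1.2) (b : Bool) : Linked r1 r2 (s, e) (Function.update s j b, e) := by
  by_cases hb : b = s j
  · subst hb
    rw [Function.update_eq_self]
    exact Relation.EqvGen.refl _
  · obtain rfl : b = !(s j) := by cases b <;> cases h : s j <;> simp_all
    have key : ∀ (e : {e : Fin 3 × Fin 3 // e.1 ≠ e.2}) (j : Fin 3), j ≠ e.1.2 →
        j = e.1.1 ∨ j = -(e.1.1 + e.1.2) := by decide
    rcases key e j hj with rfl | rfl
    · exact Linked.right r1 r2 (s, e)
    · have h1 := Linked.left r1 r2 (s, e)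
      have h2 := Linked.right r1 r2 (r1 (s, e))
      have h3 := Linked.left r1 r2 (r2 (r1 (s, e)))
      have h4 : r1 (r2 (r1 (s, e))) = (Function.update s (-(e.1.1 + e.1.2))
          (!(s (-(e.1.1 + e.1.2)))), e) :=
        by
        have h5 : (r1 (r1 (s, e))).2 = e := congrArg Prod.snd (r1_r1 (s, e))
        exact Prod.ext rfl h5
      rw [h4] at h3
      exact Relation.EqvGen.trans _ _ _ h1 (Relation.EqvGen.trans _ _ _ h2 h3)

theorem vertex_eq (x : Flag) : {y | Linked r1 r2 x y} =
    {y | y.2.1.2 = x.2.1.2 ∧ y.1 x.2.1.2 = x.1 x.2.1.2} := by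
  ext y
  constructor
  · intro h
    refine (Linked.mem_iff (S := {y : Flag | y.2.1.2 = x.2.1.2 ∧ y.1 x.2.1.2 = x.1 x.2.1.2})
      r1_r1 r2_r2 (fun _ h => h) ?_ h).1 ⟨rfl, rfl⟩
    rintro z ⟨h1, h2⟩
    refine ⟨h1, ?_⟩
    rw [← h2]
    exact Function.update_of_ne (fun h => z.2.2 (h1.trans h).symm) _ _
  · obtain ⟨s, e⟩ := x
    obtain ⟨t, e'⟩ := y
    rintro ⟨h1, h2⟩
    have key : ∀ e e' : {e : Fin 3 × Fin 3 // e.1 ≠ e.2}, e'.1.2 = e.1.2 →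
        e' = e ∨ e'.1 = (-(e.1.1 + e.1.2), e.1.2) := by decide
    have cov : ∀ (e : {e : Fin 3 × Fin 3 // e.1 ≠ e.2}) (j : Fin 3),
        -(e.1.1 + e.1.2) ≠ e.1.2 ∧ (j = e.1.1 ∨ j = e.1.2 ∨ j = -(e.1.1 + e.1.2)) := by decide
    have hA := linked_r1_r2 s e e.1.1 e.2 (t e.1.1)
    have hB := linked_r1_r2 (Function.update s e.1.1 (t e.1.1)) e (-(e.1.1 + e.1.2)) (cov e 0).1
      (t (-(e.1.1 + e.1.2)))
    have ht : Function.update (Function.update s e.1.1 (t e.1.1)) (-(e.1.1 + e.1.2))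
        (t (-(e.1.1 + e.1.2))) = t := by
      funext j
      by_cases hj : j = -(e.1.1 + e.1.2)
      · subst hj
        simp
      · rw [Function.update_of_ne hj]
        by_cases hj' : j = e.1.1
        · subst hj'
          simp
        · rw [Function.update_of_ne hj']
          rcases (cov e j).2 with h | h | h
          · exact absurd h hj'
          · rw [h]
            exact h2.symm
          · exact absurd h hj
    rw [ht] at hB
    have hAB := Relation.EqvGen.trans _ _ _ hA hB
    rcases key e e' h1 with h | h
    · rw [h]
      exact hAB
    · have h3 := Linked.left r1 r2 (t, e)
      rw [show r1 (t, e) = (t, e') from Prod.ext rfl (Subtype.ext h.symm)] at h3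
      exact Relation.EqvGen.trans _ _ _ hAB h3

theorem vertex_ncard (x : Flag) : {y | Linked r1 r2 x y}.ncard = 8 := by
  have key : ∀ (k : Fin 3) (b : Bool),
      (Finset.univ.filter fun s : Fin 3 → Bool => s k = b).card = 4 ∧
      (Finset.univ.filter
        fun e : {e : Fin 3 × Fin 3 // e.1 ≠ e.2} => e.1.2 = k).card = 2 := by decide
  have h : {y : Flag | y.2.1.2 = x.2.1.2 ∧ y.1 x.2.1.2 = x.1 x.2.1.2} =
      (↑(Finset.univ.filter fun s : Fin 3 → Bool => s x.2.1.2 = x.1 x.2.1.2) :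
        Set (Fin 3 → Bool)) ×ˢ (↑(Finset.univ.filter
        fun e : {e : Fin 3 × Fin 3 // e.1 ≠ e.2} => e.1.2 = x.2.1.2) :
        Set {e : Fin 3 × Fin 3 // e.1 ≠ e.2}) := by
    ext y
    simp [and_comm]
  rw [vertex_eq, h, Set.ncard_prod, Set.ncard_coe_finset, Set.ncard_coe_finset,
    (key _ (x.1 x.2.1.2)).1, (key _ true).2]

theorem connected (x y : Flag) :
    Relation.EqvGen (fun x y => y = r0 x ∨ y = r1 x ∨ y = r2 x) x y := by
  have hp : ∀ s e e', Relation.EqvGen (fun x y : Flag => y = r0 x ∨ y = r1 x ∨ y = r2 x)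
      (s, e) (s, e') := by
    intro s e e'
    have h : (s, e') ∈ {y | Linked r0 r1 (s, e) y} := by
      rw [polygon_eq]
      rfl
    refine Relation.EqvGen.mono ?_ _ _ h
    rintro u v (h | h)
    · exact Or.inl h
    · exact Or.inr (Or.inl h)
  have hv : ∀ s e j b, Relation.EqvGen (fun x y : Flag => y = r0 x ∨ y = r1 x ∨ y = r2 x)
      (s, e) (Function.update s j b, e) := by
    intro s e j b
    have hne : ∀ j : Fin 3, j ≠ j + 1 := by decide
    have h : Relation.EqvGen (fun x y : Flag => y = r0 x ∨ y = r1 x ∨ y = r2 x)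
        (s, ⟨(j, j + 1), hne j⟩) (Function.update s j b, ⟨(j, j + 1), hne j⟩) := by
      refine Relation.EqvGen.mono ?_ _ _ (linked_r1_r2 s ⟨(j, j + 1), hne j⟩ j (hne j) b)
      rintro u v (h | h)
      · exact Or.inr (Or.inl h)
      · exact Or.inr (Or.inr h)
    exact Relation.EqvGen.trans _ _ _ (hp _ _ _) (Relation.EqvGen.trans _ _ _ h (hp _ _ _))
  obtain ⟨s, e⟩ := x
  obtain ⟨t, e'⟩ := y
  have ht : Function.update (Function.update (Function.update s 0 (t 0)) 1 (t 1)) 2 (t 2) = t := by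
    funext j
    fin_cases j <;> simp
  have h := Relation.EqvGen.trans _ _ _ (hv s e 0 (t 0)) (Relation.EqvGen.trans _ _ _
    (hv _ e 1 (t 1)) (hv _ e 2 (t 2)))
  rw [ht] at h
  exact Relation.EqvGen.trans _ _ _ h (hp _ _ _)

theorem orientable : ∃ c : Flag → Bool,
    ∀ x, c (r0 x) = !(c x) ∧ c (r1 x) = !(c x) ∧ c (r2 x) = !(c x) := by
  refine ⟨fun x => xor (xor (x.1 0) (xor (x.1 1) (x.1 2))) (decide (x.2.1.2 = x.2.1.1 + 1)), ?_⟩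
  have h0 : ∀ e : {e : Fin 3 × Fin 3 // e.1 ≠ e.2},
      decide (-(e.1.1 + e.1.2) = e.1.1 + 1) = !(decide (e.1.2 = e.1.1 + 1)) ∧
      decide (e.1.2 = -(e.1.1 + e.1.2) + 1) = !(decide (e.1.2 = e.1.1 + 1)) := by decide
  rintro ⟨s, e⟩
  refine ⟨?_, ?_, ?_⟩
  · change xor (xor (s 0) (xor (s 1) (s 2))) (decide (-(e.1.1 + e.1.2) = e.1.1 + 1)) = _
    rw [(h0 e).1, Bool.xor_not]
  · change xor (xor (s 0) (xor (s 1) (s 2))) (decide (e.1.2 = -(e.1.1 + e.1.2) + 1)) = _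
    rw [(h0 e).2, Bool.xor_not]
  · obtain ⟨⟨i, k⟩, h⟩ := e
    have hs : ∀ i, xor (Function.update s i (!(s i)) 0) (xor (Function.update s i (!(s i)) 1)
        (Function.update s i (!(s i)) 2)) = !(xor (s 0) (xor (s 1) (s 2))) := by
      intro i
      fin_cases i <;> simp
    change xor (xor (Function.update s i (!(s i)) 0) (xor (Function.update s i (!(s i)) 1)
      (Function.update s i (!(s i)) 2))) (decide (k = i + 1)) = _
    rw [hs, Bool.not_xor]

/-- The tessellation of the sphere by eight right-angled triangles. -/
def tessellation : Tessellation 3 where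
  Flag := Flag
  finite := inferInstance
  nonempty := ⟨(fun _ => true, ⟨(0, 1), by decide⟩)⟩
  r0 := r0
  r1 := r1
  r2 := r2
  r0_r0 := r0_r0
  r1_r1 := r1_r1
  r2_r2 := r2_r2
  r0_r2 := r0_r2
  r0_r2_ne := r0_r2_ne
  connected := connected
  orientable := orientable
  polygon_ncard := polygon_ncard
  vertex_ncard := vertex_ncard

end Octahedron

/-! ### The family of examples -/

/-- The tessellated surfaces obtained from the octahedral tessellation of the sphere by repeated
doubling.  In each step, for one pair of directions `i`, `j` of the cube such that all squares of
the cube with these directions are realised, holes are made in the middle of these squares, i.e.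
the corners at the vertices of the tessellation in these squares are cut off, and the doubling is
performed along these holes.  (The assumption that every polygon has exactly one corner at one
of these vertices is part of `HoleSet`; which pairs of edges of the dual graph have the same
direction does not depend on the coordinates `χ`.) -/
inductive IsExample : (m : ℕ) → Tessellation m → Prop
  | octahedron : IsExample 3 Octahedron.tessellation
  | double {m : ℕ} (M : Tessellation m) (hM : IsExample m M) (χ : M.dualGraph ≃g cubeGraph m)
      (i j : Fin m) (hij : i ≠ j) (H : M.HoleSet)
      (hH : ∀ φ, φ ∈ H.carrier ↔
        ∃ a, χ '' M.polygonsAt (M.vertexPoint φ) = cubeSquare i j a) :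
      IsExample (m + 1) H.double

/-!
Every tessellation of the family by `m`-gons is a standard one: its triangles can be written as
triples `(x, d, s)`, where the vertex `x` of the `m`-cube is the polygon, `d : Fin m` is the number
of the side of the polygon, the sides being numbered in cyclic order, and `s` is the end of the side
at which the triangle lies; the neighbour of the polygon `x` across its side `d` is the polygon
`x + e_d`, which is its mirror image in this side.  Such an identification is a
`Tessellation.Coordinates`.  In a standard tessellation the polygons at a vertex are
`x`, `x + e_d`, `x + e_d'`, `x + e_d + e_d'` with consecutive sides `d`, `d'`, so that the realised
squares are exactly those whose two directions are cyclically adjacent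
(`Tessellation.Coordinates.isRealised_iff`).

The octahedron is standard: an octant has its sides in the three coordinate planes.  Doubling
preserves the property.  An automorphism of the cube permutes the directions
(`exists_perm_of_cubeGraph_iso`), so holes in all squares with two given directions are, whatever
coordinates of the polygons were used, cut at the same corner of every polygon
(`Tessellation.Coordinates.exists_corner_of_holeSet`).  By a rotation of the numbers of the sides
this is the corner between the last side and the side `0`, and there the new side, across which lies
the same polygon of the other copy, takes its place in the cyclic order with the next free number;
the number of the copy is the new coordinate (`Tessellation.Coordinates.double`).

The family is not empty because in a standard tessellation the corners with a fixed number are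
admissible holes (`Tessellation.Coordinates.isExample_double`).
-/

/-! ### Faces and automorphisms of the cube -/

/-- The two-dimensional face of the cube through `x` with the directions `i` and `j`. -/
def cubeFace {m : ℕ} (i j : Fin m) (x : Fin m → ZMod 2) : Set (Fin m → ZMod 2) :=
  {y | ∀ k, k ≠ i → k ≠ j → y k = x k}

theorem ZMod.two_cases (a : ZMod 2) : a = 0 ∨ a = 1 := by
  revert a; decide

theorem cubeSquare_eq_cubeFace {m : ℕ} (i j : Fin m) (x : Fin m → ZMod 2) :
    cubeSquare i j (fun k => x k.1) = cubeFace i j x := by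
  ext y
  exact ⟨fun h k hi hj => h ⟨k, hi, hj⟩, fun h k => h k.1 k.2.1 k.2.2⟩

theorem exists_cubeSquare_eq_cubeFace {m : ℕ} (i j : Fin m)
    (a : {k : Fin m // k ≠ i ∧ k ≠ j} → ZMod 2) :
    ∃ x, cubeSquare i j a = cubeFace i j x := by
  refine ⟨fun k => if h : k ≠ i ∧ k ≠ j then a ⟨k, h⟩ else 0, ?_⟩
  rw [← cubeSquare_eq_cubeFace]
  congr 1
  funext k
  simp [k.2.1, k.2.2]

theorem self_mem_cubeFace {m : ℕ} (i j : Fin m) (x : Fin m → ZMod 2) : x ∈ cubeFace i j x :=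
  fun _ _ _ => rfl

theorem cubeFace_comm {m : ℕ} (i j : Fin m) (x : Fin m → ZMod 2) :
    cubeFace i j x = cubeFace j i x := by
  ext y
  exact ⟨fun h k hi hj => h k hj hi, fun h k hi hj => h k hj hi⟩

/-- A face determines its pair of directions. -/
theorem sym2_eq_of_cubeFace_eq {m : ℕ} {i j i' j' : Fin m} (hij : i ≠ j) {x y : Fin m → ZMod 2}
    (h : cubeFace i j x = cubeFace i' j' y) : s(i, j) = s(i', j') := by
  have key : ∀ k, k = i ∨ k = j → k = i' ∨ k = j' := by
    intro k hk
    by_contra! hc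
    have h1 : x k = y k := (h ▸ self_mem_cubeFace i j x : x ∈ cubeFace i' j' y) k hc.1 hc.2
    have h2 : x + Pi.single k 1 ∈ cubeFace i j x := by
      intro l hi hj
      have : l ≠ k := by rintro rfl; exact hk.elim hi hj
      simp [this]
    rw [h] at h2
    have h3 := h2 k hc.1 hc.2
    rw [← h1] at h3
    simp at h3
  rw [Sym2.eq_iff]
  have hi := key i (Or.inl rfl)
  have hj := key j (Or.inr rfl)
  rcases hi with hi | hi <;> rcases hj with hj | hj
  · exact absurd (hi.trans hj.symm) hij
  · exact Or.inl ⟨hi, hj⟩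
  · exact Or.inr ⟨hi, hj⟩
  · exact absurd (hi.trans hj.symm) hij

theorem cubeFace_congr {m : ℕ} {i j i' j' : Fin m} (h : s(i, j) = s(i', j'))
    (x : Fin m → ZMod 2) : cubeFace i j x = cubeFace i' j' x := by
  rw [Sym2.eq_iff] at h
  rcases h with ⟨rfl, rfl⟩ | ⟨rfl, rfl⟩
  · rfl
  · exact cubeFace_comm _ _ _

theorem cubeGraph_adj_iff {m : ℕ} (x y : Fin m → ZMod 2) :
    (cubeGraph m).Adj x y ↔ ∃ k, y = x + Pi.single k 1 := by
  have two : ∀ a b : ZMod 2, a ≠ b → b = a + 1 := by decide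
  constructor
  · rintro ⟨k, hk, hu⟩
    refine ⟨k, funext fun l => ?_⟩
    by_cases hl : l = k
    · subst hl
      simpa using two _ _ hk
    · have : x l = y l := by
        by_contra hne
        exact hl (hu l hne)
      simp [hl, this]
  · rintro ⟨k, rfl⟩
    refine ⟨k, by simp, fun l hl => ?_⟩
    by_contra hne
    simp [hne] at hl

/-- A function on the vertices of the cube that takes equal values at the two ends of every edge is
constant. -/
theorem cube_const {m : ℕ} {α : Type*} (g : (Fin m → ZMod 2) → α)
    (hg : ∀ x k, g (x + Pi.single k 1) = g x) (x y : Fin m → ZMod 2) : g x = g y := by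
  suffices h : ∀ x, g x = g 0 from (h x).trans (h y).symm
  intro x
  rw [← Finset.univ_sum_single x]
  induction (Finset.univ : Finset (Fin m)) using Finset.induction_on with
  | empty => simp
  | insert k s hk ih =>
    rw [Finset.sum_insert hk, add_comm]
    rcases ZMod.two_cases (x k) with h | h
    · simpa [h] using ih
    · rw [h, hg, ih]

theorem single_one_injective {m : ℕ} :
    Function.Injective fun k : Fin m => (Pi.single k 1 : Fin m → ZMod 2) := by
  intro k l h
  by_contra hne
  have := congrFun h k
  simp [hne] at this

/-- An automorphism of the cube permutes the directions: in a four-cycle of the cube opposite edges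
have the same direction, so the direction of the image of an edge depends on the direction of the
edge only. -/
theorem exists_perm_of_cubeGraph_iso {m : ℕ} (f : cubeGraph m ≃g cubeGraph m) :
    ∃ σ : Equiv.Perm (Fin m), ∀ x y k, f x (σ k) = f y (σ k) ↔ x k = y k := by
  have hex : ∀ x k, ∃ l, f (x + Pi.single k 1) = f x + Pi.single l 1 := fun x k =>
    (cubeGraph_adj_iff _ _).1 (f.map_adj_iff.2 ((cubeGraph_adj_iff _ _).2 ⟨k, rfl⟩))
  choose δ hδ using hex
  have cancel : ∀ v : Fin m → ZMod 2, v + v = 0 := fun v => funext fun l => by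
    have : ∀ a : ZMod 2, a + a = 0 := by decide
    exact this _
  have hinj : ∀ x, Function.Injective (δ x) := by
    intro x k l h
    have h1 : f (x + Pi.single k 1) = f (x + Pi.single l 1) := by rw [hδ, hδ, h]
    exact single_one_injective (add_left_cancel (f.injective h1))
  have hstep : ∀ x k l, δ (x + Pi.single l 1) k = δ x k := by
    intro x k l
    by_cases hkl : k = l
    · subst hkl
      have h1 := hδ (x + Pi.single k 1) k
      rw [add_assoc, cancel, add_zero, hδ, add_assoc] at h1
      have h2 := add_left_cancel ((add_zero (f x)).trans h1)
      apply single_one_injective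
      have h3 := congrArg (fun v => Pi.single (δ x k) 1 + v) h2
      simp only [← add_assoc, cancel] at h3
      simpa using h3.symm
    · have h1 := hδ (x + Pi.single l 1) k
      have h2 := hδ (x + Pi.single k 1) l
      rw [show x + Pi.single l 1 + Pi.single k 1 = x + Pi.single k 1 + Pi.single l (1 : ZMod 2) by
        abel, h2, hδ, hδ, add_assoc, add_assoc] at h1
      have h3 := add_left_cancel h1
      have hne : δ x k ≠ δ x l := fun h => hkl (hinj x h)
      have h4 := congrFun h3 (δ x k)
      have hp : δ (x + Pi.single k 1) l ≠ δ x k := by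
        -- otherwise the image of the four-cycle returns to its start after two steps
        intro hp
        have h5 : f (x + Pi.single k 1 + Pi.single l 1) = f x := by
          rw [h2, hp, hδ, add_assoc, cancel, add_zero]
        have h6 := f.injective h5
        rw [add_assoc] at h6
        have h7 := congrFun (add_eq_left.1 h6) k
        simp [hkl] at h7
      by_contra hc
      rw [Pi.add_apply, Pi.add_apply, Pi.single_eq_same, Pi.single_eq_of_ne hp.symm,
        Pi.single_eq_of_ne hne, Pi.single_eq_of_ne (Ne.symm hc)] at h4
      simp at h4
  have hconst : ∀ x k, δ x k = δ 0 k := fun x k =>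
    cube_const (fun x => δ x k) (fun x l => hstep x k l) x 0
  refine ⟨Equiv.ofBijective (δ 0) (Finite.injective_iff_bijective.1 (hinj 0)), fun x y k => ?_⟩
  rw [Equiv.ofBijective_apply]
  have hg := cube_const (fun x => f x (δ 0 k) - x k) (fun x l => by
    rw [hδ, hconst x l]
    by_cases hkl : k = l
    · subst hkl
      simp
    · have : δ 0 k ≠ δ 0 l := fun h => hkl (hinj 0 h)
      simp [this, hkl]) x y
  constructor
  · intro h
    rw [h] at hg
    exact sub_right_injective hg
  · intro h
    rw [h] at hg
    exact sub_left_injective hg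

/-- If `f` acts on the directions by `σ`, it maps faces to faces, with directions moved by `σ`. -/
theorem image_cubeFace {m : ℕ} (f : cubeGraph m ≃g cubeGraph m) (σ : Equiv.Perm (Fin m))
    (hσ : ∀ x y k, f x (σ k) = f y (σ k) ↔ x k = y k) (i j : Fin m) (x : Fin m → ZMod 2) :
    f '' cubeFace i j x = cubeFace (σ i) (σ j) (f x) := by
  have h : ∀ y, f y ∈ cubeFace (σ i) (σ j) (f x) ↔ y ∈ cubeFace i j x := by
    intro y
    constructor
    · intro h k hi hj
      exact (hσ y x k).1 (h (σ k) (σ.injective.ne hi) (σ.injective.ne hj))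
    · intro h k hi hj
      have := (hσ y x (σ.symm k)).2 (h _ (by rintro rfl; simp at hi) (by rintro rfl; simp at hj))
      simpa using this
  ext z
  constructor
  · rintro ⟨y, hy, rfl⟩
    exact (h y).2 hy
  · intro hz
    obtain ⟨y, rfl⟩ := f.surjective z
    exact ⟨y, (h y).1 hz, rfl⟩

/-! ### The polygons at a vertex of the surface -/

namespace Tessellation

variable {m : ℕ} (M : Tessellation m)

theorem polygonOf_eq_iff {φ ψ : M.Flag} :
    M.polygonOf φ = M.polygonOf ψ ↔ Linked M.r0 M.r1 φ ψ :=
  ⟨fun h => Quotient.exact h, fun h => Quotient.sound h⟩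

/-- At the corner `stdSimplex.vertex 0` of a triangle the barycentric coordinate `0` is not zero, so
points there are identified only along the sides crossed by `r1` and `r2`. -/
theorem linked_of_eqvGen_glued {x y : (_ : M.Flag) × stdSimplex ℝ (Fin 3)}
    (h : Relation.EqvGen M.Glued x y) :
    x.2 = y.2 ∧ (x.2 = stdSimplex.vertex 0 → Linked M.r1 M.r2 x.1 y.1) := by
  induction h with
  | rel x y h =>
    refine ⟨h.1, fun hx => ?_⟩
    rcases h.2 with ⟨h0, -⟩ | ⟨-, h1⟩ | ⟨-, h2⟩
    · rw [hx] at h0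
      simp at h0
    · rw [h1]
      exact Linked.left _ _ _
    · rw [h2]
      exact Linked.right _ _ _
  | refl x => exact ⟨rfl, fun _ => Relation.EqvGen.refl _⟩
  | symm x y _ ih => exact ⟨ih.1.symm, fun hy => Relation.EqvGen.symm _ _ (ih.2 (ih.1.trans hy))⟩
  | trans x y z _ _ ih ih' =>
    exact ⟨ih.1.trans ih'.1, fun hx =>
      Relation.EqvGen.trans _ _ _ (ih.2 hx) (ih'.2 (ih.1.symm.trans hx))⟩

theorem vertexPoint_eq_of_linked {φ ψ : M.Flag} (h : Linked M.r1 M.r2 φ ψ) :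
    M.vertexPoint φ = M.vertexPoint ψ := by
  induction h with
  | rel x y h =>
    refine Quot.sound ⟨rfl, Or.inr ?_⟩
    rcases h with h | h
    · exact Or.inl ⟨by simp, h⟩
    · exact Or.inr ⟨by simp, h⟩
  | refl x => rfl
  | symm x y _ ih => exact ih.symm
  | trans x y z _ _ ih ih' => exact ih.trans ih'

/-- The polygons that contain the point of the surface at a vertex of the tessellation are those
which have a triangle with its corner at this vertex. -/
theorem polygonsAt_vertexPoint (φ : M.Flag) :
    M.polygonsAt (M.vertexPoint φ) = M.polygonOf '' {ψ | Linked M.r1 M.r2 φ ψ} := by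
  ext p
  constructor
  · rintro ⟨ψ, x, rfl, h⟩
    have h1 := M.linked_of_eqvGen_glued (Quot.eqvGen_exact h)
    exact ⟨ψ, h1.2 rfl, rfl⟩
  · rintro ⟨ψ, h, rfl⟩
    exact ⟨ψ, stdSimplex.vertex 0, rfl, M.vertexPoint_eq_of_linked h⟩

end Tessellation

/-! ### Coordinates on the triangles -/

theorem finRotate_ne_self {m : ℕ} (hm : 2 ≤ m) (c : Fin m) : finRotate m c ≠ c := by
  obtain ⟨n, rfl⟩ : ∃ n, m = n + 2 := ⟨m - 2, by omega⟩
  rw [finRotate_apply]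
  simp

/-- Coordinates for the triangles of a tessellation by `m`-gons that identify it with a standard
one.  The polygons are numbered by the vertices of the `m`-cube, the sides of each polygon are
numbered in cyclic order by `Fin m`, and two polygons with a common edge are mirror images of each
other in this edge.  A triangle is given by its polygon `pos`, by the number `dir` of its side, and
by the end `side` of this side at which it lies: the end shared with the next side if `side` is
`true`, and the end shared with the previous one otherwise. -/
structure Tessellation.Coordinates {m : ℕ} (M : Tessellation m) where
  pos : M.Flag → Fin m → ZMod 2
  dir : M.Flag → Fin m
  side : M.Flag → Bool
  bijective : Function.Bijective fun φ => (pos φ, dir φ, side φ)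
  pos_r0 : ∀ φ, pos (M.r0 φ) = pos φ
  pos_r1 : ∀ φ, pos (M.r1 φ) = pos φ
  pos_r2 : ∀ φ, pos (M.r2 φ) = pos φ + Pi.single (dir φ) 1
  dir_r0 : ∀ φ, dir (M.r0 φ) = dir φ
  dir_r1 : ∀ φ, dir (M.r1 φ) =
    if side φ then finRotate m (dir φ) else (finRotate m).symm (dir φ)
  dir_r2 : ∀ φ, dir (M.r2 φ) = dir φ
  side_r0 : ∀ φ, side (M.r0 φ) = !(side φ)
  side_r1 : ∀ φ, side (M.r1 φ) = !(side φ)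
  side_r2 : ∀ φ, side (M.r2 φ) = side φ

namespace Tessellation.Coordinates

variable {m : ℕ} {M : Tessellation m} (C : M.Coordinates)

theorem ext_flag {φ ψ : M.Flag} (h1 : C.pos φ = C.pos ψ) (h2 : C.dir φ = C.dir ψ)
    (h3 : C.side φ = C.side ψ) : φ = ψ :=
  C.bijective.1 (by simp only [h1, h2, h3])

theorem exists_flag (x : Fin m → ZMod 2) (d : Fin m) (s : Bool) :
    ∃ φ, C.pos φ = x ∧ C.dir φ = d ∧ C.side φ = s := by
  obtain ⟨φ, h⟩ := C.bijective.2 (x, d, s)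
  simp only [Prod.mk.injEq] at h
  exact ⟨φ, h⟩

/-- The number of the corner of its polygon at which a triangle lies; the corner number `c` is the
one between the sides with numbers `c` and `finRotate m c`. -/
def corner (φ : M.Flag) : Fin m :=
  if C.side φ then C.dir φ else (finRotate m).symm (C.dir φ)

theorem corner_r1 (φ : M.Flag) : C.corner (M.r1 φ) = C.corner φ := by
  cases h : C.side φ <;>
    simp [corner, C.side_r1, C.dir_r1, h, -finRotate_apply, -finRotate_symm_apply]

theorem corner_r2 (φ : M.Flag) : C.corner (M.r2 φ) = C.corner φ := by
  simp [corner, C.side_r2, C.dir_r2]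

theorem sym2_dir (φ : M.Flag) :
    s(C.dir φ, C.dir (M.r1 φ)) = s(C.corner φ, finRotate m (C.corner φ)) := by
  cases h : C.side φ
  · rw [Sym2.eq_swap]
    simp [corner, C.dir_r1, h, -finRotate_apply, -finRotate_symm_apply]
  · simp [corner, C.dir_r1, h]

/-- Two triangles are in the same polygon if and only if they have the same position in the cube:
`r0` moves to the other end of a side, `r1` followed by `r0` to the next or previous side. -/
theorem linked_iff (φ ψ : M.Flag) : Linked M.r0 M.r1 φ ψ ↔ C.pos φ = C.pos ψ := by
  constructor
  · intro h
    exact ((Linked.mem_iff (S := {θ | C.pos θ = C.pos φ}) M.r0_r0 M.r1_r1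
      (fun θ hθ => (C.pos_r0 θ).trans hθ) (fun θ hθ => (C.pos_r1 θ).trans hθ) h).1 rfl).symm
  · intro h
    have hflip : ∀ θ θ', C.pos θ = C.pos θ' → C.dir θ = C.dir θ' → Linked M.r0 M.r1 θ θ' := by
      intro θ θ' h1 h2
      by_cases h3 : C.side θ = C.side θ'
      · rw [C.ext_flag h1 h2 h3]
        exact Relation.EqvGen.refl _
      · rw [← C.ext_flag (φ := M.r0 θ) (ψ := θ') ((C.pos_r0 _).trans h1) ((C.dir_r0 _).trans h2)
          (by rw [C.side_r0]; cases hs : C.side θ <;> cases hs' : C.side θ' <;> simp_all)]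
        exact Linked.left _ _ _
    have hm : ∃ n, m = n + 1 := ⟨m - 1, by have := (C.dir φ).pos; omega⟩
    obtain ⟨n, rfl⟩ := hm
    -- every triangle is linked to one at the side number `0` of its polygon
    have hzero : ∀ d : Fin (n + 1), ∀ θ, C.dir θ = d →
        ∃ θ', C.dir θ' = 0 ∧ C.pos θ' = C.pos θ ∧ Linked M.r0 M.r1 θ θ' := by
      intro d
      induction d using Fin.induction with
      | zero => exact fun θ hθ => ⟨θ, hθ, rfl, Relation.EqvGen.refl _⟩
      | succ d ih =>
        intro θ hθ
        obtain ⟨θ₁, h1, h2, h3⟩ := C.exists_flag (C.pos θ) (C.dir θ) false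
        have h4 : C.dir (M.r1 θ₁) = d.castSucc := by
          rw [C.dir_r1, h3, h2, hθ, if_neg (by simp), Equiv.symm_apply_eq, finRotate_apply]
          simp
        obtain ⟨θ', h5, h6, h7⟩ := ih _ h4
        refine ⟨θ', h5, by rw [h6, C.pos_r1, h1], ?_⟩
        exact Relation.EqvGen.trans _ _ _ (hflip _ _ h1.symm h2.symm)
          (Relation.EqvGen.trans _ _ _ (Linked.right _ _ _) h7)
    obtain ⟨φ', a1, a2, a3⟩ := hzero _ φ rfl
    obtain ⟨ψ', b1, b2, b3⟩ := hzero _ ψ rfl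
    exact Relation.EqvGen.trans _ _ _ a3 (Relation.EqvGen.trans _ _ _
      (hflip _ _ (by rw [a2, b2, h]) (by rw [a1, b1])) (Relation.EqvGen.symm _ _ b3))

/-- The position of a polygon in the cube. -/
noncomputable def polygonEquiv : M.Polygon ≃ (Fin m → ZMod 2) :=
  Equiv.ofBijective (Quotient.lift C.pos fun φ ψ h => (C.linked_iff φ ψ).1 h) <| by
    constructor
    · rintro ⟨φ⟩ ⟨ψ⟩ h
      exact M.polygonOf_eq_iff.2 ((C.linked_iff φ ψ).2 h)
    · intro x
      by_cases hm : m = 0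
      · subst hm
        obtain ⟨φ⟩ := M.nonempty
        exact (C.dir φ).elim0
      · obtain ⟨φ, h, -⟩ := C.exists_flag x ⟨0, Nat.pos_of_ne_zero hm⟩ true
        exact ⟨M.polygonOf φ, h⟩

theorem polygonEquiv_polygonOf (φ : M.Flag) : C.polygonEquiv (M.polygonOf φ) = C.pos φ := rfl

/-- The coordinates of the triangles identify the dual graph with the cube. -/
noncomputable def dualIso : M.dualGraph ≃g cubeGraph m where
  toEquiv := C.polygonEquiv
  map_rel_iff' := by
    rintro ⟨φ⟩ ⟨ψ⟩
    change (cubeGraph m).Adj (C.pos φ) (C.pos ψ) ↔ M.polygonOf φ ≠ M.polygonOf ψ ∧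
      ∃ θ, M.polygonOf θ = M.polygonOf φ ∧ M.polygonOf (M.r2 θ) = M.polygonOf ψ
    simp only [← C.polygonEquiv.injective.eq_iff, C.polygonEquiv_polygonOf,
      ← C.polygonEquiv.injective.ne_iff]
    rw [cubeGraph_adj_iff]
    constructor
    · rintro ⟨k, hk⟩
      obtain ⟨θ, h1, h2, -⟩ := C.exists_flag (C.pos φ) k true
      exact ⟨by simp [hk], θ, h1, by rw [C.pos_r2, h1, h2, hk]⟩
    · rintro ⟨-, θ, h1, h2⟩
      exact ⟨C.dir θ, by rw [← h2, C.pos_r2, h1]⟩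

/-- The polygons at a vertex of the tessellation form a square of the cube. -/
theorem dualIso_image_polygonsAt (hm : 2 ≤ m) (φ : M.Flag) :
    C.dualIso '' M.polygonsAt (M.vertexPoint φ) =
      cubeFace (C.corner φ) (finRotate m (C.corner φ)) (C.pos φ) := by
  have h1 : C.dualIso '' M.polygonsAt (M.vertexPoint φ) = C.pos '' {ψ | Linked M.r1 M.r2 φ ψ} := by
    rw [M.polygonsAt_vertexPoint, Set.image_image]
    rfl
  rw [h1, ← cubeFace_congr (C.sym2_dir φ)]
  ext y
  constructor
  · rintro ⟨ψ, hψ, rfl⟩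
    refine ((Linked.mem_iff (S := {ψ | C.corner ψ = C.corner φ ∧
      C.pos ψ ∈ cubeFace (C.dir φ) (C.dir (M.r1 φ)) (C.pos φ)}) M.r1_r1 M.r2_r2 ?_ ?_ hψ).1
      ⟨rfl, self_mem_cubeFace _ _ _⟩).2
    · rintro θ ⟨h2, h3⟩
      exact ⟨(C.corner_r1 θ).trans h2, by rwa [C.pos_r1]⟩
    · rintro θ ⟨h2, h3⟩
      refine ⟨(C.corner_r2 θ).trans h2, ?_⟩
      have h4 := C.sym2_dir θ
      rw [h2, ← C.sym2_dir φ] at h4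
      intro k hi hj
      have h5 : k ≠ C.dir θ := by
        rintro rfl
        have : C.dir θ ∈ s(C.dir φ, C.dir (M.r1 φ)) := h4 ▸ Sym2.mem_mk_left _ _
        rcases Sym2.mem_iff.1 this with h | h
        · exact hi h
        · exact hj h
      rw [C.pos_r2, Pi.add_apply, Pi.single_eq_of_ne h5, add_zero]
      exact h3 k hi hj
  · intro hy
    have hne : C.dir φ ≠ C.dir (M.r1 φ) := by
      intro h
      have h2 := C.sym2_dir φ
      rw [← h, Sym2.eq_iff] at h2
      have h3 := finRotate_ne_self hm (C.corner φ)
      rcases h2 with h2 | h2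
      · exact h3 (h2.2.symm.trans h2.1)
      · exact h3 (h2.1.symm.trans h2.2)
    have two : ∀ a b : ZMod 2, a ≠ b → a = b + 1 := by decide
    have l1 : ∀ θ, Linked M.r1 M.r2 θ (M.r1 θ) := Linked.left _ _
    have l2 : ∀ θ, Linked M.r1 M.r2 θ (M.r2 θ) := Linked.right _ _
    have tr : ∀ {u v w}, Linked M.r1 M.r2 u v → Linked M.r1 M.r2 v w → Linked M.r1 M.r2 u w :=
      fun h h' => Relation.EqvGen.trans _ _ _ h h'
    have heq : ∀ ψ, C.pos ψ (C.dir φ) = y (C.dir φ) →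
        C.pos ψ (C.dir (M.r1 φ)) = y (C.dir (M.r1 φ)) →
        (∀ k, k ≠ C.dir φ → k ≠ C.dir (M.r1 φ) → C.pos ψ k = C.pos φ k) → C.pos ψ = y := by
      intro ψ h2 h3 h4
      funext k
      by_cases hk : k = C.dir φ
      · rw [hk, h2]
      · by_cases hk' : k = C.dir (M.r1 φ)
        · rw [hk', h3]
        · rw [h4 k hk hk', hy k hk hk']
    by_cases ha : y (C.dir φ) = C.pos φ (C.dir φ) <;>
      by_cases hb : y (C.dir (M.r1 φ)) = C.pos φ (C.dir (M.r1 φ))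
    · exact ⟨φ, Relation.EqvGen.refl _, heq _ ha.symm hb.symm fun _ _ _ => rfl⟩
    · refine ⟨M.r2 (M.r1 φ), tr (l1 _) (l2 _), heq _ ?_ ?_ fun k hk hk' => ?_⟩
      · simp [C.pos_r2, C.pos_r1, hne, ha]
      · simp [C.pos_r2, C.pos_r1, two _ _ hb]
      · simp [C.pos_r2, C.pos_r1, hk']
    · refine ⟨M.r2 φ, l2 _, heq _ ?_ ?_ fun k hk hk' => ?_⟩
      · simp [C.pos_r2, two _ _ ha]
      · simp [C.pos_r2, hne.symm, hb]
      · simp [C.pos_r2, hk]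
    · have hd : C.dir (M.r1 (M.r2 φ)) = C.dir (M.r1 φ) := by
        rw [C.dir_r1, C.dir_r1, C.side_r2, C.dir_r2]
      refine ⟨M.r2 (M.r1 (M.r2 φ)), tr (tr (l2 _) (l1 _)) (l2 _), heq _ ?_ ?_ fun k hk hk' => ?_⟩
      · simp [C.pos_r2, C.pos_r1, hd, hne, two _ _ ha]
      · simp [C.pos_r2, C.pos_r1, hd, hne.symm, two _ _ hb]
      · simp [C.pos_r2, C.pos_r1, hd, hk, hk']

end Tessellation.Coordinates

/-! ### The octahedron -/

/-- The side of the octant `s` in the plane where the coordinate `i` vanishes has the number `i`. -/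
def Octahedron.coordinates : Octahedron.tessellation.Coordinates where
  pos x k := if x.1 k then 1 else 0
  dir x := x.2.1.1
  side x := decide (x.2.1.1 = x.2.1.2 + 1)
  bijective := by
    have h1 : Function.Bijective fun (s : Fin 3 → Bool) (k : Fin 3) =>
        (if s k then 1 else 0 : ZMod 2) := by
      decide
    have h2 : Function.Bijective fun e : {e : Fin 3 × Fin 3 // e.1 ≠ e.2} =>
        (e.1.1, decide (e.1.1 = e.1.2 + 1)) := by
      decide
    exact h1.prodMap h2
  pos_r0 _ := rfl
  pos_r1 _ := rfl
  pos_r2 := by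
    rintro ⟨s, ⟨⟨i, k⟩, h⟩⟩
    funext l
    change (if Function.update s i (!(s i)) l then 1 else 0 : ZMod 2) =
      (if s l then 1 else 0) + (Pi.single i 1 : Fin 3 → ZMod 2) l
    by_cases hl : l = i
    · subst hl
      rw [Function.update_self, Pi.single_eq_same]
      cases s l <;> decide
    · simp [hl]
  dir_r0 _ := rfl
  dir_r1 := by
    have h : ∀ e : {e : Fin 3 × Fin 3 // e.1 ≠ e.2}, -(e.1.1 + e.1.2) =
        if decide (e.1.1 = e.1.2 + 1) then finRotate 3 e.1.1 else (finRotate 3).symm e.1.1 := by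
      decide
    exact fun x => h x.2
  dir_r2 _ := rfl
  side_r0 := by
    have h : ∀ e : {e : Fin 3 × Fin 3 // e.1 ≠ e.2},
        decide (e.1.1 = -(e.1.1 + e.1.2) + 1) = !(decide (e.1.1 = e.1.2 + 1)) := by
      decide
    exact fun x => h x.2
  side_r1 := by
    have h : ∀ e : {e : Fin 3 × Fin 3 // e.1 ≠ e.2},
        decide (-(e.1.1 + e.1.2) = e.1.2 + 1) = !(decide (e.1.1 = e.1.2 + 1)) := by
      decide
    exact fun x => h x.2
  side_r2 _ := rfl

namespace Tessellation.Coordinates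

/-! ### Coordinates on the double -/

/-- The numbers of the sides of the polygons can be rotated so that any given corner becomes the
last one. -/
theorem exists_rotate {n : ℕ} {M : Tessellation (n + 1)} (C : M.Coordinates) (c : Fin (n + 1)) :
    ∃ C' : M.Coordinates, ∀ φ, C'.corner φ = Fin.last n ↔ C.corner φ = c := by
  let ρ : Equiv.Perm (Fin (n + 1)) := Equiv.addRight (Fin.last n - c)
  have hρ : ∀ d, ρ (finRotate (n + 1) d) = finRotate (n + 1) (ρ d) := by
    intro d
    simp only [finRotate_apply, ρ, Equiv.coe_addRight]
    exact add_right_comm _ _ _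
  have hρ' : ∀ d, ρ ((finRotate (n + 1)).symm d) = (finRotate (n + 1)).symm (ρ d) := by
    intro d
    rw [Equiv.eq_symm_apply, ← hρ, Equiv.apply_symm_apply]
  have hlast : ∀ d, ρ d = Fin.last n ↔ d = c := by
    intro d
    rw [← ρ.injective.eq_iff (a := d)]
    simp [ρ]
  refine ⟨{
    pos := fun φ k => C.pos φ (ρ.symm k)
    dir := fun φ => ρ (C.dir φ)
    side := C.side
    bijective := ?_
    pos_r0 := fun φ => by simp only [C.pos_r0]
    pos_r1 := fun φ => by simp only [C.pos_r1]
    pos_r2 := fun φ => by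
      funext k
      simp only [C.pos_r2, Pi.add_apply, Pi.single_apply, Equiv.symm_apply_eq]
    dir_r0 := fun φ => by simp only [C.dir_r0]
    dir_r1 := fun φ => by
      rw [C.dir_r1]
      split_ifs
      · exact hρ _
      · exact hρ' _
    dir_r2 := fun φ => by simp only [C.dir_r2]
    side_r0 := C.side_r0
    side_r1 := C.side_r1
    side_r2 := C.side_r2 }, fun φ => ?_⟩
  · constructor
    · intro φ ψ h
      simp only [Prod.mk.injEq] at h
      refine C.ext_flag (funext fun k => ?_) (ρ.injective h.2.1) h.2.2
      simpa using congrFun h.1 (ρ k)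
    · rintro ⟨x, d, s⟩
      obtain ⟨φ, h1, h2, h3⟩ := C.exists_flag (fun k => x (ρ k)) (ρ.symm d) s
      exact ⟨φ, by simp [h1, h2, h3]⟩
  · rw [← hlast]
    simp only [corner]
    split_ifs
    · rfl
    · rw [hρ']

theorem finRotate_castSucc {n : ℕ} {d : Fin (n + 1)} (hd : d ≠ Fin.last n) :
    finRotate (n + 2) d.castSucc = (finRotate (n + 1) d).castSucc := by
  obtain ⟨e, rfl⟩ := Fin.exists_castSucc_eq.2 hd
  simp [finRotate_apply]

theorem finRotate_castSucc_last (n : ℕ) :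
    finRotate (n + 2) (Fin.last n).castSucc = Fin.last (n + 1) := by
  simp [finRotate_apply]

/-- Suppose that the holes are made at the last corners of the polygons, between the last side and
the side number `0`.  Then the new side of each polygon can be given the next free number, and the
number of the copy is the new coordinate in the cube. -/
noncomputable def double {n : ℕ} {M : Tessellation (n + 1)} (C : M.Coordinates) (H : M.HoleSet)
    (hH : ∀ φ, φ ∈ H.carrier ↔ C.corner φ = Fin.last n) : H.double.Coordinates where
  pos x := Fin.snoc (α := fun _ => ZMod 2) (C.pos (H.origin x)) (if x.2 then 1 else 0)
  dir
    | (Sum.inl φ, _) => (C.dir φ).castSucc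
    | (Sum.inr _, _) => Fin.last (n + 1)
  side
    | (Sum.inl φ, _) => C.side φ
    | (Sum.inr φ, _) => !(C.side φ.1)
  bijective := by
    have bit : ∀ a b : Bool, (if a then 1 else 0 : ZMod 2) = (if b then 1 else 0) → a = b := by
      decide
    constructor
    · intro x y h
      simp only [Prod.mk.injEq, Fin.snoc_injective2.eq_iff] at h
      obtain ⟨⟨h1, h2⟩, h3, h4⟩ := h
      rcases x with ⟨φ | ⟨φ, hφ⟩, b⟩ <;> rcases y with ⟨ψ | ⟨ψ, hψ⟩, b'⟩
      · obtain rfl : φ = ψ := C.ext_flag h1 (Fin.castSucc_injective _ h3) h4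
        obtain rfl : b = b' := bit _ _ h2
        rfl
      · exact absurd h3 (Fin.castSucc_ne_last _)
      · exact absurd h3.symm (Fin.castSucc_ne_last _)
      · have h5 : C.side φ = C.side ψ := Bool.not_inj h4
        have h6 : C.dir φ = C.dir ψ := by
          have h7 := ((hH φ).1 hφ).trans ((hH ψ).1 hψ).symm
          unfold corner at h7
          rw [h5] at h7
          split_ifs at h7
          · exact h7
          · exact (finRotate (n + 1)).symm.injective h7
        obtain rfl : φ = ψ := C.ext_flag h1 h6 h5
        obtain rfl : b = b' := bit _ _ h2
        rfl
    · rintro ⟨x, d, s⟩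
      have hx : Fin.snoc (α := fun _ => ZMod 2) (Fin.init x)
          (if decide (x (Fin.last (n + 1)) = 1) then 1 else 0) = x := by
        conv_rhs => rw [← Fin.snoc_init_self x]
        congr 1
        rcases ZMod.two_cases (x (Fin.last (n + 1))) with h | h <;> simp [h]
      induction d using Fin.lastCases with
      | cast d =>
        obtain ⟨φ, h1, h2, h3⟩ := C.exists_flag (Fin.init x) d s
        refine ⟨(Sum.inl φ, decide (x (Fin.last (n + 1)) = 1)), Prod.ext ?_ (Prod.ext ?_ h3)⟩
        · exact (congrArg (Fin.snoc (α := fun _ => ZMod 2) · _) h1).trans hx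
        · exact congrArg Fin.castSucc h2
      | last =>
        obtain ⟨φ, h1, h2, h3⟩ := C.exists_flag (Fin.init x)
          (if !s then Fin.last n else finRotate (n + 1) (Fin.last n)) (!s)
        have hφ : φ ∈ H.carrier := by
          rw [hH, corner, h2, h3]
          cases s
          · rfl
          · exact (finRotate (n + 1)).symm_apply_apply _
        refine ⟨(Sum.inr ⟨φ, hφ⟩, decide (x (Fin.last (n + 1)) = 1)),
          Prod.ext ?_ (Prod.ext rfl ?_)⟩
        · exact (congrArg (Fin.snoc (α := fun _ => ZMod 2) · _) h1).trans hx
        · exact (congrArg (!·) h3).trans (Bool.not_not s)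
  pos_r0 := by
    rintro ⟨φ | φ, b⟩
    · exact congrArg (Fin.snoc (α := fun _ => ZMod 2) · _) (C.pos_r0 φ)
    · exact congrArg (Fin.snoc (α := fun _ => ZMod 2) · _) (C.pos_r1 φ.1)
  pos_r1 := by
    rintro ⟨φ | φ, b⟩
    · change Fin.snoc (α := fun _ => ZMod 2) (C.pos (H.origin (H.doubleR1 (Sum.inl φ, b))))
        (if (H.doubleR1 (Sum.inl φ, b)).2 then 1 else 0) = _
      by_cases h : φ ∈ H.carrier
      · rw [H.doubleR1_of_mem h]
        rfl
      · rw [H.doubleR1_of_notMem h]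
        exact congrArg (Fin.snoc (α := fun _ => ZMod 2) · _) (C.pos_r1 φ)
    · rfl
  pos_r2 := by
    rintro ⟨φ | φ, b⟩
    · change Fin.snoc (α := fun _ => ZMod 2) (C.pos (M.r2 φ)) (if b then 1 else 0) =
        Fin.snoc (α := fun _ => ZMod 2) (C.pos φ) (if b then 1 else 0) +
          Pi.single (C.dir φ).castSucc 1
      funext k
      refine Fin.lastCases ?_ (fun k => ?_) k
      · simp
      · simp [C.pos_r2, Pi.single_apply]
    · change Fin.snoc (α := fun _ => ZMod 2) (C.pos φ.1) (if !b then 1 else 0) =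
        Fin.snoc (α := fun _ => ZMod 2) (C.pos φ.1) (if b then 1 else 0) +
          Pi.single (Fin.last (n + 1)) 1
      funext k
      refine Fin.lastCases ?_ (fun k => ?_) k
      · rw [Pi.add_apply, Pi.single_eq_same, Fin.snoc_last, Fin.snoc_last]
        cases b <;> decide
      · simp
  dir_r0 := by
    rintro ⟨φ | φ, b⟩
    · exact congrArg Fin.castSucc (C.dir_r0 φ)
    · rfl
  dir_r1 := by
    have hcast : ∀ d, (finRotate (n + 1)).symm d ≠ Fin.last n →
        (finRotate (n + 2)).symm d.castSucc = ((finRotate (n + 1)).symm d).castSucc := by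
      intro d hd
      rw [Equiv.symm_apply_eq, finRotate_castSucc hd, Equiv.apply_symm_apply]
    have hcast0 : ∀ d, (finRotate (n + 1)).symm d = Fin.last n →
        (finRotate (n + 2)).symm d.castSucc = Fin.last (n + 1) := by
      intro d hd
      rw [Equiv.symm_apply_eq] at hd ⊢
      simp [hd]
    rintro ⟨φ | ⟨φ, hφ⟩, b⟩
    · change (match H.doubleR1 (Sum.inl φ, b) with
        | (Sum.inl φ, _) => (C.dir φ).castSucc
        | (Sum.inr _, _) => Fin.last (n + 1)) =
          if C.side φ then finRotate (n + 2) (C.dir φ).castSucc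
          else (finRotate (n + 2)).symm (C.dir φ).castSucc
      by_cases h : φ ∈ H.carrier
      · rw [H.doubleR1_of_mem h]
        have h1 := (hH φ).1 h
        unfold corner at h1
        split_ifs at h1 ⊢
        · rw [h1, finRotate_castSucc_last]
        · rw [hcast0 _ h1]
      · rw [H.doubleR1_of_notMem h]
        have h1 := fun h' => h ((hH φ).2 h')
        unfold corner at h1
        change (C.dir (M.r1 φ)).castSucc = _
        rw [C.dir_r1]
        split_ifs at h1 ⊢
        · rw [finRotate_castSucc h1]
        · rw [hcast _ h1]
    · change (C.dir φ).castSucc = if !(C.side φ) then finRotate (n + 2) (Fin.last (n + 1))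
        else (finRotate (n + 2)).symm (Fin.last (n + 1))
      have h1 := (hH φ).1 hφ
      unfold corner at h1
      cases hs : C.side φ
      · rw [hs, if_neg (by simp), Equiv.symm_apply_eq] at h1
        rw [h1]
        simp
      · rw [hs, if_pos rfl] at h1
        rw [h1, ← finRotate_castSucc_last n]
        exact ((finRotate (n + 2)).symm_apply_apply _).symm
  dir_r2 := by
    rintro ⟨φ | φ, b⟩
    · exact congrArg Fin.castSucc (C.dir_r2 φ)
    · rfl
  side_r0 := by
    rintro ⟨φ | φ, b⟩
    · exact C.side_r0 φ
    · exact congrArg (!·) (C.side_r1 φ.1)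
  side_r1 := by
    rintro ⟨φ | φ, b⟩
    · change (match H.doubleR1 (Sum.inl φ, b) with
        | (Sum.inl φ, _) => C.side φ
        | (Sum.inr φ, _) => !(C.side φ.1)) = !(C.side φ)
      by_cases h : φ ∈ H.carrier
      · rw [H.doubleR1_of_mem h]
      · rw [H.doubleR1_of_notMem h]
        exact C.side_r1 φ
    · exact (Bool.not_not _).symm
  side_r2 := by
    rintro ⟨φ | φ, b⟩
    · exact C.side_r2 φ
    · rfl

end Tessellation.Coordinates

/-! ### The holes of a doubling -/

namespace Tessellation.Coordinates

theorem sym2_finRotate_injective {m : ℕ} (hm : 3 ≤ m) {c d : Fin m}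
    (h : s(c, finRotate m c) = s(d, finRotate m d)) : c = d := by
  obtain ⟨n, rfl⟩ : ∃ n, m = n + 3 := ⟨m - 3, by omega⟩
  rw [Sym2.eq_iff] at h
  rcases h with h | ⟨h1, h2⟩
  · exact h.1
  · rw [h1, finRotate_apply, finRotate_apply, add_assoc, add_eq_left] at h2
    have := congrArg Fin.val h2
    simp [Fin.val_add, Nat.mod_eq_of_lt (show 2 < n + 3 by omega)] at this

/-- Whatever identification of the dual graph with the cube is used to choose the holes, they are
made at the corners with one fixed number. -/
theorem exists_corner_of_holeSet {m : ℕ} {M : Tessellation m} (C : M.Coordinates) (hm : 3 ≤ m)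
    (χ : M.dualGraph ≃g cubeGraph m) {i j : Fin m} (hij : i ≠ j) (H : M.HoleSet)
    (hH : ∀ φ, φ ∈ H.carrier ↔ ∃ a, χ '' M.polygonsAt (M.vertexPoint φ) = cubeSquare i j a) :
    ∃ c, ∀ φ, φ ∈ H.carrier ↔ C.corner φ = c := by
  obtain ⟨σ, hσ⟩ := exists_perm_of_cubeGraph_iso (C.dualIso.symm.trans χ)
  have himage : ∀ φ, χ '' M.polygonsAt (M.vertexPoint φ) = cubeFace (σ (C.corner φ))
      (σ (finRotate m (C.corner φ))) ((C.dualIso.symm.trans χ) (C.pos φ)) := by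
    intro φ
    rw [← image_cubeFace _ σ hσ, ← C.dualIso_image_polygonsAt (by omega), Set.image_image]
    congr 1
    funext p
    simp
  have hmem : ∀ φ, φ ∈ H.carrier ↔
      s(C.corner φ, finRotate m (C.corner φ)).map σ = s(i, j) := by
    intro φ
    rw [hH, himage, Sym2.map_mk]
    constructor
    · rintro ⟨a, ha⟩
      obtain ⟨x, hx⟩ := exists_cubeSquare_eq_cubeFace i j a
      rw [hx] at ha
      exact (sym2_eq_of_cubeFace_eq hij ha.symm).symm
    · intro h
      exact ⟨_, (cubeFace_congr h _).trans (cubeSquare_eq_cubeFace i j _).symm⟩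
  obtain ⟨φ₀⟩ := M.nonempty
  obtain ⟨η, hη, -⟩ := H.exists_corner φ₀
  refine ⟨C.corner η, fun φ => ?_⟩
  rw [hmem] at hη
  rw [hmem, ← hη, (Sym2.map.injective σ.injective).eq_iff]
  exact ⟨sym2_finRotate_injective hm, fun h => by rw [h]⟩

/-- The corners with a given number, one in every polygon, are a set of possible holes. -/
def holeSet {m : ℕ} {M : Tessellation m} (C : M.Coordinates) (c : Fin m) : M.HoleSet where
  carrier := {φ | C.corner φ = c}
  r1_mem φ h := (C.corner_r1 φ).trans h
  r2_mem φ h := (C.corner_r2 φ).trans h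
  exists_corner := by
    intro φ
    obtain ⟨η, h1, h2, h3⟩ := C.exists_flag (C.pos φ) c true
    have hη : C.corner η = c := by simp [corner, h2, h3]
    refine ⟨η, hη, (C.linked_iff _ _).2 h1.symm, fun θ hθ hl => ?_⟩
    have hp : C.pos θ = C.pos η := ((C.linked_iff _ _).1 hl).symm.trans h1.symm
    replace hθ : C.corner θ = c := hθ
    unfold corner at hθ
    cases hs : C.side θ
    · right
      rw [hs, if_neg (by simp), Equiv.symm_apply_eq] at hθ
      exact C.ext_flag (by rw [C.pos_r1, hp]) (by rw [C.dir_r1, h2, h3, if_pos rfl, hθ])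
        (by rw [C.side_r1, h3, hs]; rfl)
    · left
      rw [hs, if_pos rfl] at hθ
      exact C.ext_flag hp (hθ.trans h2.symm) (hs.trans h3.symm)

theorem isExample_double {m : ℕ} {M : Tessellation m} (hM : IsExample m M) (C : M.Coordinates)
    (hm : 3 ≤ m) (c : Fin m) : IsExample (m + 1) (C.holeSet c).double := by
  have hne := (finRotate_ne_self (by omega) c).symm
  refine IsExample.double M hM C.dualIso c (finRotate m c) hne _ fun φ => ?_
  rw [C.dualIso_image_polygonsAt (by omega)]
  constructor
  · intro h
    obtain rfl : C.corner φ = c := h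
    exact ⟨_, (cubeSquare_eq_cubeFace _ _ _).symm⟩
  · rintro ⟨a, ha⟩
    obtain ⟨x, hx⟩ := exists_cubeSquare_eq_cubeFace c (finRotate m c) a
    rw [hx] at ha
    exact (sym2_finRotate_injective hm (sym2_eq_of_cubeFace_eq hne ha.symm)).symm

/-- The realised squares are those whose directions are the numbers of two consecutive sides. -/
theorem isRealised_iff {m : ℕ} {M : Tessellation m} (C : M.Coordinates) (hm : 2 ≤ m)
    {i j : Fin m} (hij : i ≠ j) (a : {k : Fin m // k ≠ i ∧ k ≠ j} → ZMod 2) :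
    M.IsRealised C.dualIso i j a ↔ j = finRotate m i ∨ i = finRotate m j := by
  obtain ⟨x, hx⟩ := exists_cubeSquare_eq_cubeFace i j a
  simp only [Tessellation.IsRealised, hx, C.dualIso_image_polygonsAt hm]
  constructor
  · rintro ⟨φ, h⟩
    have h1 := sym2_eq_of_cubeFace_eq hij h.symm
    rw [Sym2.eq_iff] at h1
    rcases h1 with ⟨h1, h2⟩ | ⟨h1, h2⟩
    · exact Or.inl (by rw [h2, h1])
    · exact Or.inr (by rw [h1, h2])
  · rintro (rfl | rfl)
    · obtain ⟨φ, h1, h2, h3⟩ := C.exists_flag x i true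
      have h4 : C.corner φ = i := by simp [corner, h2, h3]
      exact ⟨φ, by rw [h4, h1]⟩
    · obtain ⟨φ, h1, h2, h3⟩ := C.exists_flag x j true
      have h4 : C.corner φ = j := by simp [corner, h2, h3]
      exact ⟨φ, by rw [h4, h1, cubeFace_comm]⟩

end Tessellation.Coordinates

/-! ### The family of examples -/

theorem IsExample.three_le_and_nonempty_coordinates {m : ℕ} {M : Tessellation m}
    (hM : IsExample m M) : 3 ≤ m ∧ Nonempty M.Coordinates := by
  induction hM with
  | octahedron => exact ⟨le_rfl, ⟨Octahedron.coordinates⟩⟩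
  | @double m M hM χ i j hij H hH ih =>
    obtain ⟨hm, ⟨C⟩⟩ := ih
    obtain ⟨n, rfl⟩ : ∃ n, m = n + 1 := ⟨m - 1, by omega⟩
    obtain ⟨c, hc⟩ := C.exists_corner_of_holeSet hm χ hij H hH
    obtain ⟨C', hC'⟩ := C.exists_rotate c
    exact ⟨by omega, ⟨C'.double H fun φ => (hc φ).trans (hC' φ).symm⟩⟩

theorem exists_isExample {m : ℕ} (hm : 3 ≤ m) : ∃ M : Tessellation m, IsExample m M := by
  induction m, hm using Nat.le_induction with
  | base => exact ⟨_, IsExample.octahedron⟩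
  | succ m hm ih =>
    obtain ⟨M, hM⟩ := ih
    obtain ⟨C⟩ := hM.three_le_and_nonempty_coordinates.2
    exact ⟨_, C.isExample_double hM hm ⟨0, by omega⟩⟩

theorem eq_finRotate_iff_modEq {m : ℕ} (i j : Fin m) :
    j = finRotate m i ↔ (j : ℕ) ≡ (i : ℕ) + 1 [MOD m] := by
  obtain ⟨n, rfl⟩ : ∃ n, m = n + 1 := ⟨m - 1, by have := i.pos; omega⟩
  rw [finRotate_apply, Fin.ext_iff, Fin.val_add, Nat.ModEq, Nat.mod_eq_of_lt j.isLt, Fin.val_one',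
    Nat.add_mod_mod]

theorem lemma2 (m : ℕ) (hm : 3 ≤ m) :
    (∃ M : Tessellation m, IsExample m M) ∧
    ∀ M : Tessellation m, IsExample m M →
      ∃ χ : M.dualGraph ≃g cubeGraph m,
        ∀ (i j : Fin m), i ≠ j → ∀ a : {k : Fin m // k ≠ i ∧ k ≠ j} → ZMod 2,
          M.IsRealised χ i j a ↔
            ((j : ℕ) ≡ (i : ℕ) + 1 [MOD m] ∨ (i : ℕ) ≡ (j : ℕ) + 1 [MOD m]) := by
  refine ⟨exists_isExample hm, fun M hM => ?_⟩
  obtain ⟨C⟩ := hM.three_le_and_nonempty_coordinates.2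
  refine ⟨C.dualIso, fun i j hij a => ?_⟩
  rw [C.isRealised_iff (by omega) hij, eq_finRotate_iff_modEq, eq_finRotate_iff_modEq]
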